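/- All manifolds are real, Hausdorff, second countable and $C^\infty$, and all maps and structures are $C^\infty$. Let $M$ be an $m$-dimensional manifold with a fixed volume form $\eta$, let $\pi\colon E\to M$ be a smooth fibre bundle with $\dim E=m+n$, and let $J^1\pi$ be its first jet bundle with projections $\pi^1\colon J^1\pi\to E$ and $\bar\pi^1=\pi\circ\pi^1\colon J^1\pi\to M$. Sections of $\pi$ and $\bar\pi^1$ are local, that is, defined on open subsets of $M$. A section $\gamma$ is an integral section of a distribution $\mathcal D$ if $T_u\operatorname{Im}(\gamma)=\mathcal D_u$ for all $u\in\operatorname{Im}(\gamma)$. Let $\mathcal L=L\,(\bar\pi^1)^*\eta$, with $L\in C^\infty(J^1\pi)$, be a regular Lagrangian density, meaning that the Hessian $\partial^2L/\partial u^\alpha_i\partial u^\beta_j$ of $L$ along the fibres of $\pi^1$ is nondegenerate everywhere. Let $$\Theta_{\mathcal L}=\frac{\partial L}{\partial u^\alpha_i}\,du^\alpha\wedge d^{m-1}x_i-\Big(\frac{\partial L}{\partial u^\alpha_i}u^\alpha_i-L\Big)d^mx,\qquad \Omega_{\mathcal L}=-d\Theta_{\mathcal L}$$ be its Cartan forms,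 in adapted coordinates with $\eta=d^mx=dx^1\wedge\dots\wedge dx^m$ and $d^{m-1}x_i=i(\partial/\partial x^i)d^mx$. Let $\mathcal D_{\mathcal L}$ be an $m$-dimensional, $\bar\pi^1$-transverse, integrable distribution on $J^1\pi$ whose integral sections are prolongations $j^1\phi$ of sections $\phi$ of $\pi$ satisfying $(j^1\phi)^*\,i(X)\Omega_{\mathcal L}=0$ for every vector field $X$ on $J^1\pi$. For an $m$-dimensional distribution $\mathcal D$ on a manifold, let $\{\mathcal X\}$ be the class of associated multivector fields: the nowhere vanishing, locally decomposable $m$-multivector fields that are sections of $\Lambda^m\mathcal D$. Let $\{\mathcal X_{\mathcal L}\}$ be the class associated with $\mathcal D_{\mathcal L}$. Let $\Psi\colon E\to J^1\pi$ be a jet field (a global section of $\pi^1$), and let $\mathcal D$ be an $m$-dimensional, integrable, $\pi$-transverse distribution on $E$, with associated class $\{\mathcal X\}$. Then the following are equivalent. 1. ($\Psi$ and $\mathcal D$ satisfy the generalized Lagrangian Hamilton–Jacobi condition.) For every section $\gamma$ of $\pi$ that is an integral section of $\mathcal D$, the section $\Psi\circ\gamma$ of $\bar\pi^1$ is an integral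 section of $\mathcal D_{\mathcal L}$; that is, $$T_u\operatorname{Im}(\gamma)=\mathcal D_u\ \ \forall u\in\operatorname{Im}(\gamma)\ \Longrightarrow\ T_{\bar u}\operatorname{Im}(\Psi\circ\gamma)=(\mathcal D_{\mathcal L})_{\bar u}\ \ \forall\bar u\in\operatorname{Im}(\Psi\circ\gamma).$$ 2. ($\mathcal D$ and $\mathcal D_{\mathcal L}$ are $\Psi$-related.) For every $\mathcal X_{\mathcal L}\in\{\mathcal X_{\mathcal L}\}$ there exists $\mathcal X\in\{\mathcal X\}$, and for every $\mathcal X\in\{\mathcal X\}$ there exists $\mathcal X_{\mathcal L}\in\{\mathcal X_{\mathcal L}\}$, such that $\mathcal X_{\mathcal L}\circ\Psi=\Lambda^mT\Psi\circ\mathcal X$. -/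

import Mathlib

open Set Manifold ContDiff

noncomputable section

namespace ClassicalFieldTheory

/-! ### Smooth fibre bundles and their first jet bundles -/

section JetBundle

variable (B EE F : Type*)
  [NormedAddCommGroup B] [NormedSpace ℝ B]
  [NormedAddCommGroup EE] [NormedSpace ℝ EE]
  [NormedAddCommGroup F] [NormedSpace ℝ F]
  (M E S : Type*)
  [TopologicalSpace M] [ChartedSpace B M]
  [TopologicalSpace E] [ChartedSpace EE E]
  [TopologicalSpace S] [ChartedSpace F S]

/-- A smooth fibre bundle `proj : E → M` with typical fibre `S`: a smooth map that is locally,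
over the base, diffeomorphic to the projection of a product. The manifolds `M`, `E`, `S` are
modelled on `B`, `EE`, `F`. -/
structure SmoothFiberBundle where
  proj : E → M
  contMDiff_proj : ContMDiff 𝓘(ℝ, EE) 𝓘(ℝ, B) ∞ proj
  exists_trivialization : ∀ x : M, ∃ t : Bundle.Trivialization S proj, x ∈ t.baseSet ∧
    ContMDiffOn 𝓘(ℝ, EE) (𝓘(ℝ, B).prod 𝓘(ℝ, F)) ∞ t t.source ∧
    ContMDiffOn (𝓘(ℝ, B).prod 𝓘(ℝ, F)) 𝓘(ℝ, EE) ∞ t.toOpenPartialHomeomorph.symm t.target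

variable {B EE F M E S}

/-- A `1`-jet at `x = π u` of a local section `φ` of `π` with `φ x = u`, recorded as the point
`u` together with the tangent map `T_x φ : T_x M → T_u E`; the linear maps that arise in this way
are the right inverses of `T_u π`. -/
@[ext]
structure Jet (p : SmoothFiberBundle B EE F M E S) where
  pt : E
  lin : TangentSpace 𝓘(ℝ, B) (p.proj pt) →L[ℝ] TangentSpace 𝓘(ℝ, EE) pt
  proj_lin : (mfderiv 𝓘(ℝ, EE) 𝓘(ℝ, B) p.proj pt).comp lin = ContinuousLinearMap.id ℝ _

/-- Local coordinates `(xⁱ)` of `M` and adapted local coordinates `(xⁱ, u^α)` of `E`. -/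
structure AdaptedChart (p : SmoothFiberBundle B EE F M E S) where
  base : OpenPartialHomeomorph M B
  tot : OpenPartialHomeomorph E (B × F)
  contMDiffOn_base : ContMDiffOn 𝓘(ℝ, B) 𝓘(ℝ, B) ∞ base base.source
  contMDiffOn_base_symm : ContMDiffOn 𝓘(ℝ, B) 𝓘(ℝ, B) ∞ base.symm base.target
  contMDiffOn_tot : ContMDiffOn 𝓘(ℝ, EE) 𝓘(ℝ, B × F) ∞ tot tot.source
  contMDiffOn_tot_symm : ContMDiffOn 𝓘(ℝ, B × F) 𝓘(ℝ, EE) ∞ tot.symm tot.target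
  proj_mem : ∀ u ∈ tot.source, p.proj u ∈ base.source
  fst_tot : ∀ u ∈ tot.source, (tot u).1 = base (p.proj u)
  nonempty : tot.source.Nonempty

namespace AdaptedChart

variable {p : SmoothFiberBundle B EE F M E S} (c c' : AdaptedChart p)

/-- The differential of the coordinates `(xⁱ, u^α)` at a point of `E`. -/
def dTot (u : E) : TangentSpace 𝓘(ℝ, EE) u →L[ℝ] B × F :=
  (NormedSpace.fromTangentSpace (𝕜 := ℝ) (c.tot u)).toContinuousLinearMap.comp
    (mfderiv 𝓘(ℝ, EE) 𝓘(ℝ, B × F) c.tot u)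

/-- The differential of the coordinates `(xⁱ)` at a point of `M`. -/
def dBase (x : M) : TangentSpace 𝓘(ℝ, B) x →L[ℝ] B :=
  (NormedSpace.fromTangentSpace (𝕜 := ℝ) (c.base x)).toContinuousLinearMap.comp
    (mfderiv 𝓘(ℝ, B) 𝓘(ℝ, B) c.base x)

theorem mdifferentiable_tot : c.tot.MDifferentiable 𝓘(ℝ, EE) 𝓘(ℝ, B × F) :=
  ⟨c.contMDiffOn_tot.mdifferentiableOn (by simp), c.contMDiffOn_tot_symm.mdifferentiableOn (by simp)⟩

theorem mdifferentiable_base : c.base.MDifferentiable 𝓘(ℝ, B) 𝓘(ℝ, B) :=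
  ⟨c.contMDiffOn_base.mdifferentiableOn (by simp),
    c.contMDiffOn_base_symm.mdifferentiableOn (by simp)⟩

theorem isInvertible_dTot {u : E} (hu : u ∈ c.tot.source) : (c.dTot u).IsInvertible :=
  ⟨(c.mdifferentiable_tot.mfderiv hu).trans (NormedSpace.fromTangentSpace (𝕜 := ℝ) (c.tot u)), rfl⟩

theorem isInvertible_dBase {x : M} (hx : x ∈ c.base.source) : (c.dBase x).IsInvertible :=
  ⟨(c.mdifferentiable_base.mfderiv hx).trans (NormedSpace.fromTangentSpace (𝕜 := ℝ) (c.base x)),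
    rfl⟩

theorem hasMFDerivAt_tot {u : E} (hu : u ∈ c.tot.source) :
    HasMFDerivAt 𝓘(ℝ, EE) 𝓘(ℝ, B × F) c.tot u (c.dTot u) :=
  (c.mdifferentiable_tot.mdifferentiableAt hu).hasMFDerivAt

theorem hasMFDerivAt_base {x : M} (hx : x ∈ c.base.source) :
    HasMFDerivAt 𝓘(ℝ, B) 𝓘(ℝ, B) c.base x (c.dBase x) :=
  (c.mdifferentiable_base.mdifferentiableAt hx).hasMFDerivAt

/-- The adapted coordinates intertwine `T π` with the projection `B × F → B`. -/
theorem fst_comp_dTot {u : E} (hu : u ∈ c.tot.source) :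
    (ContinuousLinearMap.fst ℝ B F).comp (c.dTot u) =
      (c.dBase (p.proj u)).comp (mfderiv 𝓘(ℝ, EE) 𝓘(ℝ, B) p.proj u) := by
  have h1 : HasMFDerivAt 𝓘(ℝ, EE) 𝓘(ℝ, B) (fun v => (c.tot v).1) u
      ((ContinuousLinearMap.fst ℝ B F).comp (c.dTot u)) :=
    HasMFDerivAt.comp u
      ((ContinuousLinearMap.fst ℝ B F).hasFDerivAt.hasMFDerivAt (x := c.tot u))
      (c.hasMFDerivAt_tot hu)
  have h2 : HasMFDerivAt 𝓘(ℝ, EE) 𝓘(ℝ, B) (fun v => c.base (p.proj v)) u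
      ((c.dBase (p.proj u)).comp (mfderiv 𝓘(ℝ, EE) 𝓘(ℝ, B) p.proj u)) :=
    HasMFDerivAt.comp u (c.hasMFDerivAt_base (c.proj_mem u hu))
      ((p.contMDiff_proj.mdifferentiable (by simp)) u).hasMFDerivAt
  have h3 : (fun v => (c.tot v).1) =ᶠ[nhds u] (fun v => c.base (p.proj v)) :=
    Filter.eventuallyEq_of_mem (c.tot.open_source.mem_nhds hu) c.fst_tot
  exact hasMFDerivAt_unique h1 (h2.congr_of_eventuallyEq h3)

/-- The jet at `u` with coordinates `u_i^α` given by `q`. -/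
def mkJet (u : E) (hu : u ∈ c.tot.source) (q : B →L[ℝ] F) : Jet p where
  pt := u
  lin := (c.dTot u).inverse.comp (((ContinuousLinearMap.id ℝ B).prod q).comp (c.dBase (p.proj u)))
  proj_lin := by
    have hb := c.isInvertible_dBase (c.proj_mem u hu)
    have ht := c.isInvertible_dTot hu
    ext v
    apply hb.injective
    have := DFunLike.congr_fun (c.fst_comp_dTot hu)
      ((c.dTot u).inverse (c.dBase (p.proj u) v, q (c.dBase (p.proj u) v)))
    simp only [ContinuousLinearMap.comp_apply, ht.self_apply_inverse] at this
    simpa using this.symm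

open Classical in
/-- The inverse of the coordinates `(xⁱ, u^α, u_i^α)` of the jet bundle (with a junk value outside
the range of the coordinates). -/
def jetChartInv (y : (B × F) × (B →L[ℝ] F)) : Jet p :=
  if h : y.1 ∈ c.tot.target then c.mkJet (c.tot.symm y.1) (c.tot.map_target h) y.2
  else c.mkJet c.nonempty.some c.nonempty.some_mem 0

theorem jetChartInv_eq {y : (B × F) × (B →L[ℝ] F)} (h : y.1 ∈ c.tot.target) :
    c.jetChartInv y = c.mkJet (c.tot.symm y.1) (c.tot.map_target h) y.2 := dif_pos h

/-- The chart `(xⁱ, u^α, u_i^α)` of the jet bundle induced by an adapted chart: a `1`-jet `T_x φ`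
is sent to the coordinates of its point and the derivative in coordinates of `u^α ∘ φ`. -/
def jetChart : PartialEquiv (Jet p) ((B × F) × (B →L[ℝ] F)) where
  toFun j := (c.tot j.pt, (ContinuousLinearMap.snd ℝ B F).comp
    ((c.dTot j.pt).comp (j.lin.comp (c.dBase (p.proj j.pt)).inverse)))
  invFun := c.jetChartInv
  source := {j | j.pt ∈ c.tot.source}
  target := c.tot.target ×ˢ univ
  map_source' j hj := ⟨c.tot.map_source hj, mem_univ _⟩
  map_target' y hy := by
    change (c.jetChartInv y).pt ∈ c.tot.source
    rw [c.jetChartInv_eq hy.1]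
    exact c.tot.map_target hy.1
  left_inv' j hj := by
    obtain ⟨u, h, hP⟩ := j
    change u ∈ c.tot.source at hj
    rw [c.jetChartInv_eq (c.tot.map_source hj)]
    have key : ∀ (w : E) (hw : w ∈ c.tot.source), w = u → ∀ q : B →L[ℝ] F,
        q = (ContinuousLinearMap.snd ℝ B F).comp
          ((c.dTot u).comp (h.comp (c.dBase (p.proj u)).inverse)) →
        c.mkJet w hw q = ⟨u, h, hP⟩ := by
      rintro w hw rfl q rfl
      have hb := c.isInvertible_dBase (c.proj_mem w hw)
      have ht := c.isInvertible_dTot hw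
      simp only [mkJet, Jet.mk.injEq, true_and]
      ext v
      apply ht.injective
      simp only [ContinuousLinearMap.comp_apply, ht.self_apply_inverse,
        ContinuousLinearMap.prod_apply, ContinuousLinearMap.id_apply, hb.inverse_apply_self]
      have h1 := DFunLike.congr_fun (c.fst_comp_dTot hw) (h v)
      have h2 := DFunLike.congr_fun hP v
      simp only [ContinuousLinearMap.comp_apply, ContinuousLinearMap.id_apply] at h1 h2
      rw [h2] at h1
      exact Prod.ext h1.symm rfl
    exact key _ _ (c.tot.left_inv hj) _ rfl
  right_inv' y hy := by
    obtain ⟨y, q⟩ := y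
    have h := hy.1
    change y ∈ c.tot.target at h
    rw [c.jetChartInv_eq (y := (y, q)) h]
    have hu := c.tot.map_target h
    have hb := c.isInvertible_dBase (c.proj_mem _ hu)
    have ht := c.isInvertible_dTot hu
    refine Prod.ext (c.tot.right_inv h) ?_
    ext v
    have h1 := hb.self_apply_inverse v
    have h2 := ht.self_apply_inverse (v, q v)
    rw [← h1] at h2
    exact (congrArg Prod.snd h2).trans (by rw [h1])

theorem proj_dTot_inverse {u : E} (hu : u ∈ c.tot.source) (q : B →L[ℝ] F) (v : B) :
    mfderiv 𝓘(ℝ, EE) 𝓘(ℝ, B) p.proj u ((c.dTot u).inverse (v, q v)) =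
      (c.dBase (p.proj u)).inverse v := by
  have h := DFunLike.congr_fun (c.mkJet u hu q).proj_lin ((c.dBase (p.proj u)).inverse v)
  change mfderiv 𝓘(ℝ, EE) 𝓘(ℝ, B) p.proj u ((c.dTot u).inverse
    (c.dBase (p.proj u) ((c.dBase (p.proj u)).inverse v),
      q (c.dBase (p.proj u) ((c.dBase (p.proj u)).inverse v)))) = _ at h
  rwa [(c.isInvertible_dBase (c.proj_mem u hu)).self_apply_inverse] at h

/-- The change of adapted coordinates on `E`. -/
def trans (y : B × F) : B × F := c'.tot (c.tot.symm y)

/-- The domain of the change of adapted coordinates on `E`. -/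
def overlap : Set (B × F) := c.tot.target ∩ c.tot.symm ⁻¹' c'.tot.source

theorem isOpen_overlap : IsOpen (c.overlap c') := (c.tot.symm.trans c'.tot).open_source

theorem contDiffOn_trans :
    ContDiffOn ℝ ∞ (c.trans c') (c.overlap c') := by
  rw [← contMDiffOn_iff_contDiffOn]
  exact c'.contMDiffOn_tot.comp (c.contMDiffOn_tot_symm.mono fun y hy => hy.1) fun y hy => hy.2

theorem fderiv_trans {y : B × F} (hy : y ∈ c.overlap c') :
    fderiv ℝ (c.trans c') y =
      (c'.dTot (c.tot.symm y)).comp (c.dTot (c.tot.symm y)).inverse := by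
  have hu : c.tot.symm y ∈ c.tot.source := c.tot.map_target hy.1
  have h1 : DifferentiableAt ℝ (c.trans c') y :=
    ((c.contDiffOn_trans c').differentiableOn (by simp)).differentiableAt
      ((c.isOpen_overlap c').mem_nhds hy)
  have h2 : DifferentiableAt ℝ (c.trans c') (c.tot (c.tot.symm y)) := by
    rwa [c.tot.right_inv hy.1]
  have h3 : HasMFDerivAt 𝓘(ℝ, EE) 𝓘(ℝ, B × F) (c.trans c' ∘ c.tot) (c.tot.symm y)
      ((fderiv ℝ (c.trans c') (c.tot (c.tot.symm y))).comp (c.dTot (c.tot.symm y))) :=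
    HasMFDerivAt.comp _ h2.hasFDerivAt.hasMFDerivAt (c.hasMFDerivAt_tot hu)
  have h4 : c'.tot =ᶠ[nhds (c.tot.symm y)] c.trans c' ∘ c.tot :=
    Filter.eventuallyEq_of_mem (c.tot.open_source.mem_nhds hu) fun v hv => by
      simp [trans, c.tot.left_inv hv]
  have h5 := hasMFDerivAt_unique (c'.hasMFDerivAt_tot hy.2) (h3.congr_of_eventuallyEq h4)
  rw [c.tot.right_inv hy.1] at h5
  refine ContinuousLinearMap.ext fun v => ?_
  have h6 := DFunLike.congr_fun h5 ((c.dTot (c.tot.symm y)).inverse v)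
  rw [ContinuousLinearMap.comp_apply]
  refine Eq.trans ?_ h6.symm
  exact congrArg _ ((c.isInvertible_dTot hu).self_apply_inverse v).symm

theorem jetChart_trans_source :
    (c.jetChart.symm.trans c'.jetChart).source = (c.overlap c') ×ˢ univ := by
  ext ⟨y, q⟩
  simp only [PartialEquiv.trans_source, PartialEquiv.symm_source, mem_inter_iff, mem_preimage,
    mem_prod, mem_univ, and_true, overlap]
  have h0 : (y, q) ∈ c.jetChart.target ↔ y ∈ c.tot.target := by simp [jetChart]
  rw [h0]
  refine and_congr_right fun h => ?_
  change (c.jetChartInv (y, q)).pt ∈ c'.tot.source ↔ _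
  rw [c.jetChartInv_eq (y := (y, q)) h]
  rfl

/-- The matrix of the tangent map of a section, in the new coordinates. -/
def transLin (z : (B × F) × (B →L[ℝ] F)) : B →L[ℝ] B × F :=
  (fderiv ℝ (c.trans c') z.1).comp ((ContinuousLinearMap.id ℝ B).prod z.2)

theorem fst_transLin {z : (B × F) × (B →L[ℝ] F)}
    (hz : z.1 ∈ c.overlap c') :
    (ContinuousLinearMap.fst ℝ B F).comp (c.transLin c' z) =
      (c'.dBase (p.proj (c.tot.symm z.1))).comp (c.dBase (p.proj (c.tot.symm z.1))).inverse := by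
  have hu : c.tot.symm z.1 ∈ c.tot.source := c.tot.map_target hz.1
  have hb := c.isInvertible_dBase (c.proj_mem _ hu)
  rw [transLin, fderiv_trans c c' hz]
  ext v
  have h1 := DFunLike.congr_fun (c'.fst_comp_dTot hz.2)
    ((c.dTot (c.tot.symm z.1)).inverse (v, z.2 v))
  exact h1.trans (congrArg _ (c.proj_dTot_inverse hu z.2 v))

theorem jetChart_trans_eq {z : (B × F) × (B →L[ℝ] F)}
    (hz : z.1 ∈ c.overlap c') :
    c'.jetChart (c.jetChart.symm z) = (c.trans c' z.1, (ContinuousLinearMap.snd ℝ B F).comp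
      ((c.transLin c' z).comp
        ((ContinuousLinearMap.fst ℝ B F).comp (c.transLin c' z)).inverse)) := by
  have hu : c.tot.symm z.1 ∈ c.tot.source := c.tot.map_target hz.1
  have hb := c.isInvertible_dBase (c.proj_mem _ hu)
  have hb' := c'.isInvertible_dBase (c'.proj_mem _ hz.2)
  rw [fst_transLin c c' hz, hb'.inverse_comp_of_left, hb.inverse_inverse, transLin,
    fderiv_trans c c' hz]
  have h : z.1 ∈ c.tot.target := hz.1
  change c'.jetChart (c.jetChartInv z) = _
  rw [c.jetChartInv_eq h]
  rfl

theorem isInvertible_fst_transLin {z : (B × F) × (B →L[ℝ] F)}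
    (hz : z.1 ∈ c.overlap c') :
    ((ContinuousLinearMap.fst ℝ B F).comp (c.transLin c' z)).IsInvertible := by
  rw [fst_transLin c c' hz]
  exact (c'.isInvertible_dBase (c'.proj_mem _ hz.2)).comp
    (c.isInvertible_dBase (c.proj_mem _ (c.tot.map_target hz.1))).inverse

theorem contDiffOn_jetChart_trans [CompleteSpace B] :
    ContDiffOn ℝ ∞ (c.jetChart.symm.trans c'.jetChart)
      (c.jetChart.symm.trans c'.jetChart).source := by
  rw [jetChart_trans_source]
  have ho := c.isOpen_overlap c'
  have hT := c.contDiffOn_trans c'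
  have hfst : MapsTo (Prod.fst : (B × F) × (B →L[ℝ] F) → B × F)
      ((c.overlap c') ×ˢ univ) (c.overlap c') :=
    fun z hz => hz.1
  have hD : ContDiffOn ℝ ∞ (c.transLin c') ((c.overlap c') ×ˢ univ) := by
    refine ContDiffOn.clm_comp ((hT.fderiv_of_isOpen ho (m := ∞) (by simp)).comp
      contDiff_fst.contDiffOn hfst) ?_
    have : ContDiff ℝ ∞ fun z : (B × F) × (B →L[ℝ] F) =>
        (ContinuousLinearMap.inl ℝ B F) + (ContinuousLinearMap.inr ℝ B F).comp z.2 :=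
      contDiff_const.add (contDiff_const.clm_comp contDiff_snd)
    refine this.contDiffOn.congr fun z _ => ?_
    ext v <;> simp
  have hI : ContDiffOn ℝ ∞
      (fun z => ((ContinuousLinearMap.fst ℝ B F).comp (c.transLin c' z)).inverse)
      ((c.overlap c') ×ˢ univ) := fun z hz =>
    ((c.isInvertible_fst_transLin c' hz.1).contDiffAt_map_inverse).comp_contDiffWithinAt
      (f := fun z => (ContinuousLinearMap.fst ℝ B F).comp (c.transLin c' z)) z
      ((contDiffOn_const.clm_comp hD) z hz)
  have hS : ContDiffOn ℝ ∞ (fun _ => ContinuousLinearMap.snd ℝ B F) (c.overlap c' ×ˢ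
      (univ : Set (B →L[ℝ] F))) := contDiffOn_const
  refine ContDiffOn.congr ((hT.comp contDiff_fst.contDiffOn hfst).prodMk
    (hS.clm_comp (hD.clm_comp hI))) fun z hz => ?_
  exact c.jetChart_trans_eq c' hz.1

/-- Adapted coordinates exist around every point. -/
theorem exists_mem [IsManifold 𝓘(ℝ, B) ∞ M] [IsManifold 𝓘(ℝ, F) ∞ S]
    (p : SmoothFiberBundle B EE F M E S) (u : E) : ∃ c : AdaptedChart p, u ∈ c.tot.source := by
  obtain ⟨t, hx, ht, ht'⟩ := p.exists_trivialization (p.proj u)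
  have hu : u ∈ t.source := by rwa [t.mem_source]
  let φ := chartAt B (p.proj u)
  let ψ := chartAt F (t u).2
  have hpr : ∀ v ∈ t.source, (t v).1 = p.proj v := fun v hv => t.coe_fst hv
  have hφ := contMDiffOn_chart (I := 𝓘(ℝ, B)) (n := ∞) (x := p.proj u)
  have hφ' := contMDiffOn_chart_symm (I := 𝓘(ℝ, B)) (n := ∞) (x := p.proj u)
  have hψ := contMDiffOn_chart (I := 𝓘(ℝ, F)) (n := ∞) (x := (t u).2)
  have hψ' := contMDiffOn_chart_symm (I := 𝓘(ℝ, F)) (n := ∞) (x := (t u).2)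
  refine ⟨{ base := φ
            tot := t.toOpenPartialHomeomorph.trans (φ.prod ψ)
            contMDiffOn_base := hφ
            contMDiffOn_base_symm := hφ'
            contMDiffOn_tot := ?_
            contMDiffOn_tot_symm := ?_
            proj_mem := ?_
            fst_tot := ?_
            nonempty := ⟨u, ?_⟩ }, ?_⟩
  · have h1 : ContMDiffOn 𝓘(ℝ, EE) 𝓘(ℝ, B) ∞ (fun v => φ (t v).1)
        (t.toOpenPartialHomeomorph.trans (φ.prod ψ)).source :=
      hφ.comp (contMDiff_fst.comp_contMDiffOn (ht.mono fun v hv => hv.1)) fun v hv => hv.2.1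
    have h2 : ContMDiffOn 𝓘(ℝ, EE) 𝓘(ℝ, F) ∞ (fun v => ψ (t v).2)
        (t.toOpenPartialHomeomorph.trans (φ.prod ψ)).source :=
      hψ.comp (contMDiff_snd.comp_contMDiffOn (ht.mono fun v hv => hv.1)) fun v hv => hv.2.2
    exact h1.prodMk_space h2
  · have h1 : ContMDiffOn 𝓘(ℝ, B × F) 𝓘(ℝ, B) ∞ (fun y : B × F => φ.symm y.1)
        (t.toOpenPartialHomeomorph.trans (φ.prod ψ)).target :=
      hφ'.comp contDiff_fst.contMDiff.contMDiffOn fun y hy => hy.1.1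
    have h2 : ContMDiffOn 𝓘(ℝ, B × F) 𝓘(ℝ, F) ∞ (fun y : B × F => ψ.symm y.2)
        (t.toOpenPartialHomeomorph.trans (φ.prod ψ)).target :=
      hψ'.comp contDiff_snd.contMDiff.contMDiffOn fun y hy => hy.1.2
    exact ht'.comp (h1.prodMk h2) fun y hy => hy.2
  · intro v hv
    rw [← hpr v hv.1]
    exact hv.2.1
  · intro v hv
    change φ (t v).1 = _
    rw [hpr v hv.1]
  all_goals
    refine ⟨hu, ?_, mem_chart_source F _⟩
    change (t u).1 ∈ φ.source
    rw [hpr u hu]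
    exact mem_chart_source B _

end AdaptedChart

namespace Jet

variable [CompleteSpace B] [IsManifold 𝓘(ℝ, B) ∞ M] [IsManifold 𝓘(ℝ, F) ∞ S]
  (p : SmoothFiberBundle B EE F M E S)

/-- The manifold structure of the jet bundle is the one given by all the charts
`(xⁱ, u^α, u_i^α)` induced by adapted charts. -/
def chartedSpaceCore : ChartedSpaceCore ((B × F) × (B →L[ℝ] F)) (Jet p) where
  atlas := range AdaptedChart.jetChart
  chartAt j := (AdaptedChart.exists_mem p j.pt).choose.jetChart
  mem_chart_source j := (AdaptedChart.exists_mem p j.pt).choose_spec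
  chart_mem_atlas j := mem_range_self _
  open_source := by
    rintro _ _ ⟨c, rfl⟩ ⟨c', rfl⟩
    rw [AdaptedChart.jetChart_trans_source]
    exact (c.isOpen_overlap c').prod isOpen_univ
  continuousOn_toFun := by
    rintro _ _ ⟨c, rfl⟩ ⟨c', rfl⟩
    exact (c.contDiffOn_jetChart_trans c').continuousOn

instance : TopologicalSpace (Jet p) := (chartedSpaceCore p).toTopologicalSpace

instance : ChartedSpace ((B × F) × (B →L[ℝ] F)) (Jet p) := (chartedSpaceCore p).toChartedSpace

instance : IsManifold 𝓘(ℝ, (B × F) × (B →L[ℝ] F)) ∞ (Jet p) := by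
  apply isManifold_of_contDiffOn
  intro e e' he he'
  obtain ⟨_, ⟨c, rfl⟩, rfl⟩ := mem_iUnion₂.1 he
  obtain ⟨_, ⟨c', rfl⟩, rfl⟩ := mem_iUnion₂.1 he'
  exact (c.contDiffOn_jetChart_trans c').mono inter_subset_left

end Jet

end JetBundle

/-! ### Multilinear algebra -/

section Algebra

variable {V W : Type*}
  [AddCommGroup V] [Module ℝ V] [TopologicalSpace V] [IsTopologicalAddGroup V] [ContinuousSMul ℝ V]
  [AddCommGroup W] [Module ℝ W] [TopologicalSpace W]

/-- Alternating forms on a finite-dimensional space are continuous. -/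
def alternatingMapToContinuous [T2Space V] [FiniteDimensional ℝ V] {k : ℕ}
    (f : V [⋀^Fin k]→ₗ[ℝ] ℝ) : V [⋀^Fin k]→L[ℝ] ℝ :=
  { f with
    cont := by
      let b := Module.finBasis ℝ V
      have h : (fun v : Fin k → V => f v) = fun v => ∑ r : Fin k → Fin (Module.finrank ℝ V),
          (∏ i, b.coord (r i) (v i)) * f (fun i => b (r i)) := by
        funext v
        have hv : v = fun i => ∑ l, b.coord l (v i) • b l := by
          funext i
          simp [b.sum_repr (v i)]
        conv_lhs => rw [hv]
        change f.toMultilinearMap _ = _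
        rw [MultilinearMap.map_sum]
        refine Finset.sum_congr rfl fun r _ => ?_
        rw [MultilinearMap.map_smul_univ]
        rfl
      change Continuous fun v : Fin k → V => f v
      rw [h]
      refine continuous_finsetSum _ fun r _ => Continuous.mul ?_ continuous_const
      exact continuous_finsetProd _ fun i _ =>
        ((b.coord (r i)).continuous_of_finiteDimensional).comp (continuous_apply i) }

/-- For an alternating form `θ` on `W`, a linear map `P : V → W` and a bilinear map
`β : W* × V → ℝ`, the alternating form
`(v₁, …, v_k) ↦ ∑ᵢ β (w ↦ θ (P v₁, …, w, …, P v_k)) vᵢ` on `V`, with `w` in the `i`-th place. -/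
def slotSum {k : ℕ} (θ : W [⋀^Fin k]→L[ℝ] ℝ) (P : V →L[ℝ] W)
    (β : (W →L[ℝ] ℝ) →ₗ[ℝ] V →ₗ[ℝ] ℝ) : V [⋀^Fin k]→ₗ[ℝ] ℝ where
  toFun v := ∑ i, β (θ.toContinuousLinearMap (fun l => P (v l)) i) (v i)
  map_update_add' := by
    intro inst v i x y
    obtain rfl : inst = instDecidableEqFin k := Subsingleton.elim _ _
    rw [← Finset.sum_add_distrib]
    refine Finset.sum_congr rfl fun l _ => ?_
    have hP : ∀ z, (fun l => P (Function.update v i z l)) =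
        Function.update (fun l => P (v l)) i (P z) := fun z => Function.comp_update P v i z
    simp only [hP]
    by_cases hl : l = i
    · subst hl
      have h : ∀ z, θ.toContinuousLinearMap (Function.update (fun l => P (v l)) l z) l =
          θ.toContinuousLinearMap (fun l => P (v l)) l := fun z => by
        ext w
        simp [ContinuousAlternatingMap.toContinuousLinearMap]
      simp only [h, Function.update_self, map_add]
    · have h : θ.toContinuousLinearMap (Function.update (fun l => P (v l)) i (P (x + y))) l =
          θ.toContinuousLinearMap (Function.update (fun l => P (v l)) i (P x)) l +
          θ.toContinuousLinearMap (Function.update (fun l => P (v l)) i (P y)) l := by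
        ext w
        simp only [ContinuousAlternatingMap.toContinuousLinearMap_apply, add_apply,
          Function.update_comm (Ne.symm hl), map_add, ContinuousAlternatingMap.map_update_add]
      rw [h]
      simp [Function.update_of_ne hl]
  map_update_smul' := by
    intro inst v i a x
    obtain rfl : inst = instDecidableEqFin k := Subsingleton.elim _ _
    rw [smul_eq_mul, Finset.mul_sum]
    refine Finset.sum_congr rfl fun l _ => ?_
    have hP : ∀ z, (fun l => P (Function.update v i z l)) =
        Function.update (fun l => P (v l)) i (P z) := fun z => Function.comp_update P v i z
    simp only [hP]
    by_cases hl : l = i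
    · subst hl
      have h : ∀ z, θ.toContinuousLinearMap (Function.update (fun l => P (v l)) l z) l =
          θ.toContinuousLinearMap (fun l => P (v l)) l := fun z => by
        ext w
        simp [ContinuousAlternatingMap.toContinuousLinearMap]
      simp only [h, Function.update_self, map_smul, smul_eq_mul]
    · have h : θ.toContinuousLinearMap (Function.update (fun l => P (v l)) i (P (a • x))) l =
          a • θ.toContinuousLinearMap (Function.update (fun l => P (v l)) i (P x)) l := by
        ext w
        simp only [ContinuousAlternatingMap.toContinuousLinearMap_apply, smul_apply,
          Function.update_comm (Ne.symm hl), map_smul, ContinuousAlternatingMap.map_update_smul]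
      rw [h]
      simp [Function.update_of_ne hl]
  map_eq_zero_of_eq' := by
    intro v i j hv hij
    have h0 : ∀ l, l ≠ i → l ≠ j → θ.toContinuousLinearMap (fun l => P (v l)) l = 0 := by
      intro l hi hj
      ext w
      refine θ.map_eq_zero_of_eq _ (i := i) (j := j) ?_ hij
      simp [Function.update_of_ne hi.symm, Function.update_of_ne hj.symm, hv]
    have h1 : θ.toContinuousLinearMap (fun l => P (v l)) j =
        -θ.toContinuousLinearMap (fun l => P (v l)) i := by
      ext w
      have h2 : Function.update (fun l => P (v l)) j w =
          Function.update (fun l => P (v l)) i w ∘ Equiv.swap i j := by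
        funext l
        rcases eq_or_ne l i with rfl | hi
        · simp [Function.update_of_ne hij, Function.update_of_ne hij.symm, hv]
        · rcases eq_or_ne l j with rfl | hj
          · simp
          · simp [Function.update_of_ne hi, Function.update_of_ne hj,
              Equiv.swap_apply_of_ne_of_ne hi hj]
      change θ (Function.update (fun l => P (v l)) j w) = -θ (Function.update (fun l => P (v l)) i w)
      rw [h2]
      exact θ.toAlternatingMap.map_swap _ hij
    rw [Finset.sum_eq_add i j hij (fun l _ hl => by simp [h0 l hl.1 hl.2]) (by simp) (by simp),
      h1, hv]
    simp

end Algebra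

/-! ### Differential forms, distributions and multivector fields on a manifold -/

section Manifolds

variable {V N : Type*} [NormedAddCommGroup V] [NormedSpace ℝ V] [TopologicalSpace N]
  [ChartedSpace V N]

/-- The local expression of a `k`-form in the chart around `x₀`. -/
def formInChart {k : ℕ} (θ : ∀ x : N, TangentSpace 𝓘(ℝ, V) x [⋀^Fin k]→L[ℝ] ℝ) (x₀ : N) (y : V) :
    V [⋀^Fin k]→L[ℝ] ℝ :=
  (θ ((chartAt V x₀).symm y)).compContinuousLinearMap
    ((mfderiv 𝓘(ℝ, V) 𝓘(ℝ, V) (chartAt V x₀).symm y).comp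
      (NormedSpace.fromTangentSpace (𝕜 := ℝ) y).symm.toContinuousLinearMap)

/-- A `k`-form is smooth if its local expressions are. -/
def IsSmoothForm {k : ℕ} (θ : ∀ x : N, TangentSpace 𝓘(ℝ, V) x [⋀^Fin k]→L[ℝ] ℝ) : Prop :=
  ∀ x₀ : N, ContDiffOn ℝ ∞ (formInChart θ x₀) (chartAt V x₀).target

/-- The exterior derivative of a `k`-form, computed at `x` in the chart around `x`. -/
def formExtDeriv {k : ℕ} (θ : ∀ x : N, TangentSpace 𝓘(ℝ, V) x [⋀^Fin k]→L[ℝ] ℝ) (x : N) :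
    TangentSpace 𝓘(ℝ, V) x [⋀^Fin (k + 1)]→L[ℝ] ℝ :=
  (extDeriv (formInChart θ x) (chartAt V x x)).compContinuousLinearMap
    ((NormedSpace.fromTangentSpace (𝕜 := ℝ) (chartAt V x x)).toContinuousLinearMap.comp
      (mfderiv 𝓘(ℝ, V) 𝓘(ℝ, V) (chartAt V x) x))

/-- A volume form on a manifold (of dimension `k`): a smooth nowhere vanishing `k`-form. -/
structure IsVolumeForm {k : ℕ} (θ : ∀ x : N, TangentSpace 𝓘(ℝ, V) x [⋀^Fin k]→L[ℝ] ℝ) :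
    Prop where
  smooth : IsSmoothForm θ
  ne_zero : ∀ x, θ x ≠ 0

variable [IsManifold 𝓘(ℝ, V) ∞ N]

/-- The vector field `X` is smooth on `U`. -/
def IsSmoothVectorFieldOn (X : ∀ x : N, TangentSpace 𝓘(ℝ, V) x) (U : Set N) : Prop :=
  ContMDiffOn 𝓘(ℝ, V) 𝓘(ℝ, V).tangent ∞ (fun x => (⟨x, X x⟩ : TangentBundle 𝓘(ℝ, V) N)) U

variable (V N) in
/-- A `k`-dimensional (smooth) distribution: a subbundle of rank `k` of the tangent bundle. -/
structure TangentDistribution (k : ℕ) where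
  space : ∀ x : N, Submodule ℝ (TangentSpace 𝓘(ℝ, V) x)
  exists_frame : ∀ x₀ : N, ∃ U : Set N, IsOpen U ∧ x₀ ∈ U ∧
    ∃ X : Fin k → ∀ x : N, TangentSpace 𝓘(ℝ, V) x, (∀ i, IsSmoothVectorFieldOn (X i) U) ∧
      ∀ x ∈ U, LinearIndependent ℝ (fun i => X i x) ∧
        Submodule.span ℝ (range fun i => X i x) = space x

/-- A multivector field `X` of degree `k` is locally decomposable if around every point it is
`X₁ ∧ ⋯ ∧ X_k` for smooth vector fields `X₁, …, X_k` (in particular it is smooth). -/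
def IsLocallyDecomposable {k : ℕ} (X : ∀ x : N, ⋀[ℝ]^k (TangentSpace 𝓘(ℝ, V) x)) : Prop :=
  ∀ x₀ : N, ∃ U : Set N, IsOpen U ∧ x₀ ∈ U ∧
    ∃ Y : Fin k → ∀ x : N, TangentSpace 𝓘(ℝ, V) x, (∀ i, IsSmoothVectorFieldOn (Y i) U) ∧
      ∀ x ∈ U, X x = exteriorPower.ιMulti ℝ k fun i => Y i x

namespace TangentDistribution

/-- `D` is integrable: through every point passes an integral manifold of `D`, that is, an immersed
`k`-dimensional submanifold (locally parametrized by an open subset of `ℝ^k`) whose tangent spaces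
are the spaces of `D`. -/
def IsIntegrable {k : ℕ} (D : TangentDistribution V N k) : Prop :=
  ∀ x : N, ∃ (U : Set (EuclideanSpace ℝ (Fin k))) (f : EuclideanSpace ℝ (Fin k) → N),
    IsOpen U ∧ 0 ∈ U ∧ f 0 = x ∧ ContMDiffOn 𝓘(ℝ, EuclideanSpace ℝ (Fin k)) 𝓘(ℝ, V) ∞ f U ∧
    ∀ t ∈ U, Function.Injective (mfderiv 𝓘(ℝ, EuclideanSpace ℝ (Fin k)) 𝓘(ℝ, V) f t) ∧
      (mfderiv 𝓘(ℝ, EuclideanSpace ℝ (Fin k)) 𝓘(ℝ, V) f t).range = D.space (f t)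

/-- The equivalence class `{X}` of multivector fields associated with the distribution `D`: the
nowhere vanishing, locally decomposable `k`-multivector fields that are sections of `Λ^k D`. -/
def multivectorClass {k : ℕ} (D : TangentDistribution V N k) :
    Set (∀ x : N, ⋀[ℝ]^k (TangentSpace 𝓘(ℝ, V) x)) :=
  {X | (∀ x, X x ≠ 0) ∧ IsLocallyDecomposable X ∧
    ∀ x, X x ∈ LinearMap.range (exteriorPower.map k (D.space x).subtype)}

variable {B M : Type*} [NormedAddCommGroup B] [NormedSpace ℝ B] [TopologicalSpace M]
  [ChartedSpace B M]

/-- `D` is transverse to `q : N → M`: its spaces are complementary to the kernels of `T q`. -/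
def IsTransverse {k : ℕ} (D : TangentDistribution V N k) (q : N → M) : Prop :=
  ∀ x, IsCompl (D.space x) (mfderiv 𝓘(ℝ, V) 𝓘(ℝ, B) q x).ker

/-- `γ` is an integral section of `D` over `U`: the tangent spaces of its image are the spaces of
`D`. -/
def IsIntegralSectionOn {k : ℕ} (D : TangentDistribution V N k) (U : Set M) (γ : M → N) : Prop :=
  ∀ x ∈ U, (mfderiv 𝓘(ℝ, B) 𝓘(ℝ, V) γ x).range = D.space (γ x)

/-- The distributions `D` and `D'` are `f`-related: every multivector field of the class of `D'` is
`f`-related to some multivector field of the class of `D`, and conversely, where `X'` and `X` are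
`f`-related if `X' ∘ f = Λ^k T f ∘ X`. -/
def IsRelated {k : ℕ} [IsManifold 𝓘(ℝ, B) ∞ M] (f : N → M) (D : TangentDistribution V N k)
    (D' : TangentDistribution B M k) : Prop :=
  (∀ X' ∈ D'.multivectorClass, ∃ X ∈ D.multivectorClass, ∀ x,
    X' (f x) = exteriorPower.map k (mfderiv 𝓘(ℝ, V) 𝓘(ℝ, B) f x).toLinearMap (X x)) ∧
  (∀ X ∈ D.multivectorClass, ∃ X' ∈ D'.multivectorClass, ∀ x,
    X' (f x) = exteriorPower.map k (mfderiv 𝓘(ℝ, V) 𝓘(ℝ, B) f x).toLinearMap (X x))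

end TangentDistribution

end Manifolds

section LocalSection

variable {B V M N : Type*} [NormedAddCommGroup B] [NormedSpace ℝ B] [NormedAddCommGroup V]
  [NormedSpace ℝ V] [TopologicalSpace M] [ChartedSpace B M] [TopologicalSpace N] [ChartedSpace V N]

/-- `γ` is a smooth local section of `q : N → M` on the open set `U` (the values of `γ` outside
`U` are irrelevant). -/
structure IsLocalSection (q : N → M) (U : Set M) (γ : M → N) : Prop where
  isOpen : IsOpen U
  contMDiffOn : ContMDiffOn 𝓘(ℝ, B) 𝓘(ℝ, V) ∞ γ U
  proj_apply : ∀ x ∈ U, q (γ x) = x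

end LocalSection

/-! ### The Lagrangian formalism -/

section Lagrangian

variable {B EE F : Type*}
  [NormedAddCommGroup B] [NormedSpace ℝ B] [FiniteDimensional ℝ B]
  [NormedAddCommGroup EE] [NormedSpace ℝ EE] [FiniteDimensional ℝ EE]
  [NormedAddCommGroup F] [NormedSpace ℝ F]
  {M E S : Type*}
  [TopologicalSpace M] [ChartedSpace B M] [IsManifold 𝓘(ℝ, B) ∞ M]
  [TopologicalSpace E] [ChartedSpace EE E] [IsManifold 𝓘(ℝ, EE) ∞ E]
  [TopologicalSpace S] [ChartedSpace F S] [IsManifold 𝓘(ℝ, F) ∞ S]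
  {p : SmoothFiberBundle B EE F M E S}

instance (x : M) : FiniteDimensional ℝ (TangentSpace 𝓘(ℝ, B) x) :=
  inferInstanceAs (FiniteDimensional ℝ B)

instance (x : M) : T2Space (TangentSpace 𝓘(ℝ, B) x) := inferInstanceAs (T2Space B)

namespace Jet

/-- The projection of the jet bundle onto the base `M`. -/
def base (j : Jet p) : M := p.proj j.pt

/-- `j` is the `1`-jet of `φ` at its base point. -/
def IsJetOf (j : Jet p) (φ : M → E) : Prop :=
  ∀ v : TangentSpace 𝓘(ℝ, B) (p.proj j.pt),
    tangentMap 𝓘(ℝ, B) 𝓘(ℝ, EE) φ ⟨p.proj j.pt, v⟩ = ⟨j.pt, j.lin v⟩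

variable (p) in
/-- `T_x^*M ⊗ V_u π`, with `x = π u`: the linear maps from `T_x M` to the vertical space at `u`. -/
def vertHom (u : E) :
    Submodule ℝ (TangentSpace 𝓘(ℝ, B) (p.proj u) →L[ℝ] TangentSpace 𝓘(ℝ, EE) u) where
  carrier := {A | (mfderiv 𝓘(ℝ, EE) 𝓘(ℝ, B) p.proj u).comp A = 0}
  add_mem' {A A'} hA hA' := by
    ext v
    have h := DFunLike.congr_fun hA v
    have h' := DFunLike.congr_fun hA' v
    simp_all
  zero_mem' := by ext v; simp
  smul_mem' a A hA := by
    ext v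
    have h := DFunLike.congr_fun hA v
    simp_all

/-- The translate `j + A` in the fibre of the jet bundle over `E`, which is an affine space
modelled on `T_x^*M ⊗ V_u π`. -/
def translate (j : Jet p) (A : vertHom p j.pt) : Jet p where
  pt := j.pt
  lin := j.lin + A.1
  proj_lin := by
    have h : (mfderiv 𝓘(ℝ, EE) 𝓘(ℝ, B) p.proj j.pt).comp A.1 = 0 := A.2
    rw [ContinuousLinearMap.comp_add, h, add_zero, j.proj_lin]

/-- The rank one element `α ⊗ (v - T φ (T π v))` of `T_x^*M ⊗ V_u π`, where `j` is the jet of `φ`;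
the map `v ↦ v - T φ (T π v)` is the vertical differential. -/
def rankOne (j : Jet p) (α : TangentSpace 𝓘(ℝ, B) (p.proj j.pt) →L[ℝ] ℝ)
    (v : TangentSpace 𝓘(ℝ, EE) j.pt) : vertHom p j.pt :=
  ⟨α.smulRight (v - j.lin (mfderiv 𝓘(ℝ, EE) 𝓘(ℝ, B) p.proj j.pt v)), by
    ext w
    have h := DFunLike.congr_fun j.proj_lin (mfderiv 𝓘(ℝ, EE) 𝓘(ℝ, B) p.proj j.pt v)
    simp only [ContinuousLinearMap.comp_apply, ContinuousLinearMap.id_apply] at h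
    simp [h]⟩

end Jet

/-- The derivative of the Lagrangian function `L` at `j` along the fibre of the jet bundle over
`E`; in coordinates `A ↦ (∂L/∂u_i^α) A_i^α`. -/
def fiberDeriv (L : Jet p → ℝ) (j : Jet p) : Jet.vertHom p j.pt →L[ℝ] ℝ :=
  fderiv ℝ (fun A => L (j.translate A)) 0

/-- The Hessian of `L` at `j` along the fibre of the jet bundle over `E`; in coordinates
`∂²L/∂u_i^α∂u_j^β`. -/
def fiberHessian (L : Jet p → ℝ) (j : Jet p) :
    Jet.vertHom p j.pt →L[ℝ] Jet.vertHom p j.pt →L[ℝ] ℝ :=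
  fderiv ℝ (fderiv ℝ fun A => L (j.translate A)) 0

/-- The Lagrangian is regular: its Hessian along the fibres of the jet bundle over `E` is
nondegenerate at every point. -/
def IsRegularLagrangian (L : Jet p → ℝ) : Prop :=
  ∀ j, ∀ A : Jet.vertHom p j.pt, (∀ A', fiberHessian L j A A' = 0) → A = 0

/-- The bilinear map `(α, v) ↦ (∂L/∂u_i^α) (α ⊗ (v - T φ (T π v)))_i^α`. -/
def fiberDerivBilin (L : Jet p → ℝ) (j : Jet p) :
    (TangentSpace 𝓘(ℝ, B) (p.proj j.pt) →L[ℝ] ℝ) →ₗ[ℝ] TangentSpace 𝓘(ℝ, EE) j.pt →ₗ[ℝ] ℝ :=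
  LinearMap.mk₂ ℝ (fun α v => fiberDeriv L j (j.rankOne α v))
    (fun α α' v => by
      rw [← map_add]; congr 1; ext w; simp [Jet.rankOne, add_smul])
    (fun a α v => by
      rw [← map_smul]; congr 1; ext w; simp [Jet.rankOne, mul_smul])
    (fun α v v' => by
      rw [← map_add]; congr 1; ext w; simp [Jet.rankOne, add_sub_add_comm])
    (fun a α v => by
      rw [← map_smul]; congr 1; ext w; simp [Jet.rankOne, smul_sub, smul_comm a])

variable {m : ℕ}

/-- The Cartan `m`-form of the Lagrangian density `L η`,
`Θ_L = (∂L/∂u_i^α) (du^α - u_j^α dx^j) ∧ i(∂/∂x^i) η + L η`, as a form on `J¹π`. It is evaluated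
on tangent vectors through their projections `v₁, …, v_m` to `E`:
`L η(T π v₁, …, T π v_m)` plus the sum over `k` of the fibre derivative of `L` applied to
`(w ↦ η(T π v₁, …, w, …, T π v_m)) ⊗ (v_k - T φ (T π v_k))`. -/
def cartanForm (η : ∀ x : M, TangentSpace 𝓘(ℝ, B) x [⋀^Fin m]→L[ℝ] ℝ) (L : Jet p → ℝ)
    (j : Jet p) : TangentSpace 𝓘(ℝ, (B × F) × (B →L[ℝ] F)) j [⋀^Fin m]→L[ℝ] ℝ :=
  (L j • (η (p.proj j.pt)).compContinuousLinearMap (mfderiv 𝓘(ℝ, EE) 𝓘(ℝ, B) p.proj j.pt) +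
    alternatingMapToContinuous (slotSum (η (p.proj j.pt))
      (mfderiv 𝓘(ℝ, EE) 𝓘(ℝ, B) p.proj j.pt) (fiberDerivBilin L j))).compContinuousLinearMap
    (mfderiv 𝓘(ℝ, (B × F) × (B →L[ℝ] F)) 𝓘(ℝ, EE) (Jet.pt : Jet p → E) j)

/-- The Cartan `(m+1)`-form `Ω_L = -dΘ_L`. -/
def cartanFormSucc (η : ∀ x : M, TangentSpace 𝓘(ℝ, B) x [⋀^Fin m]→L[ℝ] ℝ) (L : Jet p → ℝ)
    (j : Jet p) : TangentSpace 𝓘(ℝ, (B × F) × (B →L[ℝ] F)) j [⋀^Fin (m + 1)]→L[ℝ] ℝ :=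
  -formExtDeriv (cartanForm η L) j

/-- The field equation for a section `ψ` of `J¹π` over `U`: `ψ^* i(X) Ω_L = 0` for every smooth
vector field `X` on `J¹π`. -/
def SatisfiesFieldEquation (η : ∀ x : M, TangentSpace 𝓘(ℝ, B) x [⋀^Fin m]→L[ℝ] ℝ)
    (L : Jet p → ℝ) (U : Set M) (ψ : M → Jet p) : Prop :=
  ∀ X : (∀ j : Jet p, TangentSpace 𝓘(ℝ, (B × F) × (B →L[ℝ] F)) j),
    IsSmoothVectorFieldOn X univ → ∀ x ∈ U, ∀ v : Fin m → TangentSpace 𝓘(ℝ, B) x,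
      cartanFormSucc η L (ψ x) (Matrix.vecCons (X (ψ x)) fun i =>
        mfderiv 𝓘(ℝ, B) 𝓘(ℝ, (B × F) × (B →L[ℝ] F)) ψ x (v i)) = 0

/-- `D` is a solution of the Lagrangian problem: a distribution on `J¹π` that is transverse to the
base, integrable, and whose integral sections are prolongations `j¹φ` of sections `φ` of `π`
satisfying the field equation. -/
structure IsLagrangianDistribution (η : ∀ x : M, TangentSpace 𝓘(ℝ, B) x [⋀^Fin m]→L[ℝ] ℝ)
    (L : Jet p → ℝ) (D : TangentDistribution ((B × F) × (B →L[ℝ] F)) (Jet p) m) : Prop where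
  transverse : D.IsTransverse (B := B) (Jet.base : Jet p → M)
  integrable : D.IsIntegrable
  holonomic : ∀ (U : Set M) (ψ : M → Jet p),
    IsLocalSection (B := B) (V := (B × F) × (B →L[ℝ] F)) Jet.base U ψ →
    D.IsIntegralSectionOn (B := B) U ψ →
      ∃ φ : M → E, IsLocalSection (B := B) (V := EE) p.proj U φ ∧ (∀ x ∈ U, (ψ x).IsJetOf φ) ∧
        SatisfiesFieldEquation η L U ψ

/-! ### The generalized Hamilton–Jacobi problem -/

variable (p) in
/-- A jet field: a smooth section of `J¹π → E`. -/
structure JetField where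
  toFun : E → Jet p
  contMDiff : ContMDiff 𝓘(ℝ, EE) 𝓘(ℝ, (B × F) × (B →L[ℝ] F)) ∞ toFun
  pt_toFun : ∀ u, (toFun u).pt = u

/-- The condition of the generalized Lagrangian Hamilton–Jacobi problem: if `γ` is a (local)
section of `π` that is an integral section of `D`, then `Ψ ∘ γ` is an integral section of `DL`. -/
def SatisfiesHJCondition (Ψ : JetField p) (D : TangentDistribution EE E m)
    (DL : TangentDistribution ((B × F) × (B →L[ℝ] F)) (Jet p) m) : Prop :=
  ∀ (U : Set M) (γ : M → E), IsLocalSection (B := B) (V := EE) p.proj U γ →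
    D.IsIntegralSectionOn (B := B) U γ → DL.IsIntegralSectionOn (B := B) U (Ψ.toFun ∘ γ)

end Lagrangian

end ClassicalFieldTheory

end

open ClassicalFieldTheory

/-!
Write `q` for the projection to the base. Transversality makes `T_u q` an isomorphism of `D_u` onto
the tangent space of the base, so every nowhere vanishing decomposable multivector field of top
degree along `q` lifts uniquely to the class of `D`. Both conditions of the theorem are equivalent
to `TΨ (D_u) = (D_L)_{Ψ u}` for all `u`. For the first, integrability and the inverse function
theorem give an integral section through every point `u`, and the tangent space of its image under
`Ψ` is `TΨ (D_u)`. For the second, given this equality, a member of either class is found by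
projecting a member of the other to the base and lifting it; conversely, a nonzero element of
`Λᵐ P` with `dim P = m` determines `P`, and the dual of the volume form lifts to a member of the
class of `D_L`.
-/

namespace ClassicalFieldTheory

section KVectors

variable {K V W : Type*} [Field K] [AddCommGroup V] [Module K V] [AddCommGroup W] [Module K W]
  {k : ℕ}

theorem ιMulti_ne_zero_iff {v : Fin k → V} :
    exteriorPower.ιMulti K k v ≠ 0 ↔ LinearIndependent K v := by
  refine ⟨fun h => by_contra fun hv => h (AlternatingMap.map_linearDependent _ _ hv),
    fun hv h => ?_⟩
  let b := Module.Basis.span hv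
  have hb : exteriorPower.ιMulti K k b = 0 := by
    refine exteriorPower.map_injective_field
      (Submodule.subtype_injective (Submodule.span K (range v))) ?_
    rw [exteriorPower.map_apply_ιMulti, map_zero, ← h]
    exact congrArg _ (funext fun i => congrArg Subtype.val (Module.Basis.span_apply hv i))
  have hdet := exteriorPower.alternatingMapLinearEquiv_apply_ιMulti b.det b
  rw [hb, map_zero, b.det_self] at hdet
  exact zero_ne_one hdet

theorem ι_mul_ιMulti_eq_zero_iff {v : Fin k → V} (hv : LinearIndependent K v) {w : V} :
    ExteriorAlgebra.ι K w * (exteriorPower.ιMulti K k v : ExteriorAlgebra K V) = 0 ↔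
      w ∈ Submodule.span K (range v) := by
  have hcons : ExteriorAlgebra.ι K w * (exteriorPower.ιMulti K k v : ExteriorAlgebra K V) =
      exteriorPower.ιMulti K (k + 1) (Fin.cons w v : Fin (k + 1) → V) := by
    rw [exteriorPower.ιMulti_apply_coe, exteriorPower.ιMulti_apply_coe,
      ExteriorAlgebra.ιMulti_succ_apply]
    rfl
  rw [hcons, ZeroMemClass.coe_eq_zero, ← not_iff_not, ← ne_eq, ιMulti_ne_zero_iff,
    linearIndependent_finCons, and_iff_right hv]

theorem alternatingMapLinearEquiv_bijective [FiniteDimensional K V]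
    (hV : Module.finrank K V = k) {f : V [⋀^Fin k]→ₗ[K] K} (hf : f ≠ 0) :
    Function.Bijective (exteriorPower.alternatingMapLinearEquiv f) := by
  have hdim : Module.finrank K (⋀[K]^k V) = Module.finrank K K := by
    rw [exteriorPower.finrank_eq, hV, Nat.choose_self, Module.finrank_self]
  have hsurj : Function.Surjective (exteriorPower.alternatingMapLinearEquiv f) :=
    LinearMap.surjective ((map_ne_zero_iff _ (LinearEquiv.injective _)).2 hf)
  exact ⟨(LinearMap.injective_iff_surjective_of_finrank_eq_finrank hdim).2 hsurj, hsurj⟩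

variable (k) in
/-- The `k`-vectors of a subspace `P` of `V`: the image of `Λᵏ P` in `Λᵏ V`. -/
noncomputable abbrev kVectors (P : Submodule K V) : Submodule K (⋀[K]^k V) :=
  LinearMap.range (exteriorPower.map k P.subtype)

variable {P : Submodule K V} {Q : Submodule K W} {f : V →ₗ[K] W}

theorem mem_kVectors_top (ξ : ⋀[K]^k V) : ξ ∈ kVectors k (⊤ : Submodule K V) :=
  exteriorPower.map_surjective (fun v => ⟨⟨v, trivial⟩, rfl⟩) ξ

theorem map_mem_kVectors (hf : P.map f ≤ Q) {ξ : ⋀[K]^k V} (hξ : ξ ∈ kVectors k P) :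
    exteriorPower.map k f ξ ∈ kVectors k Q := by
  obtain ⟨ζ, rfl⟩ := hξ
  refine ⟨exteriorPower.map k (f.restrict (Submodule.map_le_iff_le_comap.1 hf)) ζ, ?_⟩
  rw [← LinearMap.comp_apply, ← LinearMap.comp_apply, ← exteriorPower.map_comp,
    ← exteriorPower.map_comp]
  rfl

theorem map_injOn_kVectors (hf : Disjoint P (LinearMap.ker f)) :
    InjOn (exteriorPower.map k f) (kVectors k P : Set (⋀[K]^k V)) := by
  rintro _ ⟨ζ, rfl⟩ _ ⟨ζ', rfl⟩ h
  simp only [← LinearMap.comp_apply, ← exteriorPower.map_comp] at h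
  exact congrArg _ (exteriorPower.map_injective_field
    (LinearMap.injective_domRestrict_iff.2 hf) h)

theorem le_finrank_of_mem_kVectors [FiniteDimensional K P] {ξ : ⋀[K]^k V}
    (hξ : ξ ∈ kVectors k P) (h0 : ξ ≠ 0) : k ≤ Module.finrank K P := by
  by_contra! hlt
  have hdim : Module.finrank K (⋀[K]^k P) = 0 := by
    rw [exteriorPower.finrank_eq, Nat.choose_eq_zero_of_lt hlt]
  have : Subsingleton (⋀[K]^k P) := Module.finrank_zero_iff.1 hdim
  obtain ⟨ζ, rfl⟩ := hξ
  exact h0 (by rw [Subsingleton.elim ζ 0, map_zero])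

theorem exists_eq_smul_ιMulti_basis [FiniteDimensional K P] (b : Module.Basis (Fin k) K P)
    {ξ : ⋀[K]^k V} (hξ : ξ ∈ kVectors k P) :
    ∃ c : K, ξ = c • exteriorPower.ιMulti K k fun i => (b i : V) := by
  obtain ⟨ζ, rfl⟩ := hξ
  have hdim : Module.finrank K (⋀[K]^k P) = 1 := by
    rw [exteriorPower.finrank_eq, Module.finrank_eq_card_basis b, Fintype.card_fin,
      Nat.choose_self]
  obtain ⟨c, rfl⟩ :=
    exists_smul_eq_of_finrank_eq_one hdim (ιMulti_ne_zero_iff.2 b.linearIndependent) ζ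
  exact ⟨c, by rw [map_smul, exteriorPower.map_apply_ιMulti]; rfl⟩

theorem mem_iff_ι_mul_eq_zero_of_mem_kVectors [FiniteDimensional K P] (hP : Module.finrank K P = k)
    {ξ : ⋀[K]^k V} (hξ : ξ ∈ kVectors k P) (h0 : ξ ≠ 0) {w : V} :
    w ∈ P ↔ ExteriorAlgebra.ι K w * (ξ : ExteriorAlgebra K V) = 0 := by
  let b := Module.finBasisOfFinrankEq K P hP
  obtain ⟨c, rfl⟩ := exists_eq_smul_ιMulti_basis b hξ
  have hspan : Submodule.span K (range fun i => (b i : V)) = P := by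
    rw [show (fun i => (b i : V)) = P.subtype ∘ b from rfl, range_comp, ← Submodule.map_span,
      b.span_eq, Submodule.map_subtype_top]
  have hb : LinearIndependent K fun i => (b i : V) :=
    b.linearIndependent.map' P.subtype P.ker_subtype
  rw [Submodule.coe_smul, mul_smul_comm, smul_eq_zero_iff_right (left_ne_zero_of_smul h0),
    ι_mul_ιMulti_eq_zero_iff hb, hspan]

theorem coe_exteriorPower_map (f : V →ₗ[K] W) (ξ : ⋀[K]^k V) :
    (exteriorPower.map k f ξ : ExteriorAlgebra K W) = ExteriorAlgebra.map f ξ := by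
  have h : (⋀[K]^k W).subtype ∘ₗ exteriorPower.map k f =
      (ExteriorAlgebra.map f).toLinearMap ∘ₗ (⋀[K]^k V).subtype := by
    refine exteriorPower.linearMap_ext (AlternatingMap.ext fun v => ?_)
    simp [ExteriorAlgebra.map_apply_ιMulti]
  exact LinearMap.congr_fun h ξ

theorem map_eq_of_map_mem_kVectors [FiniteDimensional K P] [FiniteDimensional K Q]
    (hP : Module.finrank K P = k) (hQ : Module.finrank K Q = k) {ξ : ⋀[K]^k V}
    (hξ : ξ ∈ kVectors k P) (hfξ : exteriorPower.map k f ξ ∈ kVectors k Q)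
    (h0 : exteriorPower.map k f ξ ≠ 0) : P.map f = Q := by
  have hξ0 : ξ ≠ 0 := fun h => h0 (by rw [h, map_zero])
  have hle : P.map f ≤ Q := by
    rintro _ ⟨v, hv, rfl⟩
    rw [mem_iff_ι_mul_eq_zero_of_mem_kVectors hQ hfξ h0, coe_exteriorPower_map,
      ← ExteriorAlgebra.map_apply_ι, ← map_mul,
      (mem_iff_ι_mul_eq_zero_of_mem_kVectors hP hξ hξ0).1 hv, map_zero]
  refine Submodule.eq_of_le_of_finrank_le hle ?_
  rw [hQ]
  exact le_finrank_of_mem_kVectors (map_mem_kVectors le_rfl hξ) h0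

end KVectors

section FieldsAlong

variable {V N B M : Type*} [NormedAddCommGroup V] [NormedSpace ℝ V] [TopologicalSpace N]
  [ChartedSpace V N] [NormedAddCommGroup B] [NormedSpace ℝ B] [TopologicalSpace M]
  [ChartedSpace B M] [IsManifold 𝓘(ℝ, B) ∞ M] {k : ℕ}

variable (V) in
/-- The vector field `Y` along the map `q : N → M`, with `Y x` a tangent vector at `q x`, is smooth
on `U`. The model space `V` of `N` is explicit since it does not occur in `q` and `Y`. -/
def IsSmoothVectorFieldAlongOn (q : N → M) (Y : ∀ x : N, TangentSpace 𝓘(ℝ, B) (q x))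
    (U : Set N) : Prop :=
  ContMDiffOn 𝓘(ℝ, V) 𝓘(ℝ, B).tangent ∞ (fun x => (⟨q x, Y x⟩ : TangentBundle 𝓘(ℝ, B) M)) U

variable (V) in
/-- The multivector field `W` along the map `q : N → M` is around every point of `N` an exterior
product of smooth vector fields along `q`; for `q = id` this is `IsLocallyDecomposable`. -/
def IsLocallyDecomposableAlong (q : N → M)
    (W : ∀ x : N, ⋀[ℝ]^k (TangentSpace 𝓘(ℝ, B) (q x))) : Prop :=
  ∀ x₀ : N, ∃ U : Set N, IsOpen U ∧ x₀ ∈ U ∧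
    ∃ Y : Fin k → ∀ x : N, TangentSpace 𝓘(ℝ, B) (q x),
      (∀ i, IsSmoothVectorFieldAlongOn V q (Y i) U) ∧
        ∀ x ∈ U, W x = exteriorPower.ιMulti ℝ k fun i => Y i x

section Functoriality

variable {V' N' : Type*} [NormedAddCommGroup V'] [NormedSpace ℝ V'] [TopologicalSpace N']
  [ChartedSpace V' N'] {q : N → M}

theorem IsLocallyDecomposableAlong.comp {W : ∀ x : N, ⋀[ℝ]^k (TangentSpace 𝓘(ℝ, B) (q x))}
    (hW : IsLocallyDecomposableAlong V q W) {g : N' → N}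
    (hg : ContMDiff 𝓘(ℝ, V') 𝓘(ℝ, V) ∞ g) :
    IsLocallyDecomposableAlong V' (q ∘ g) fun y => W (g y) := fun y₀ => by
  obtain ⟨U, hU, hy₀, Y, hY, hWY⟩ := hW (g y₀)
  exact ⟨g ⁻¹' U, hU.preimage hg.continuous, hy₀, fun i y => Y i (g y),
    fun i => (hY i).comp hg.contMDiffOn fun _ hy => hy, fun y hy => hWY (g y) hy⟩

variable [IsManifold 𝓘(ℝ, V') ∞ N']

theorem IsSmoothVectorFieldAlongOn.mfderiv {U : Set N} {Y : ∀ x : N, TangentSpace 𝓘(ℝ, B) (q x)}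
    (hY : IsSmoothVectorFieldAlongOn V q Y U) {g : M → N'}
    (hg : ContMDiff 𝓘(ℝ, B) 𝓘(ℝ, V') ∞ g) :
    IsSmoothVectorFieldAlongOn V (g ∘ q)
      (fun x => mfderiv 𝓘(ℝ, B) 𝓘(ℝ, V') g (q x) (Y x)) U :=
  (hg.contMDiff_tangentMap (m := ∞) (by simp)).comp_contMDiffOn hY

theorem IsLocallyDecomposableAlong.map_mfderiv
    {W : ∀ x : N, ⋀[ℝ]^k (TangentSpace 𝓘(ℝ, B) (q x))}
    (hW : IsLocallyDecomposableAlong V q W) {g : M → N'}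
    (hg : ContMDiff 𝓘(ℝ, B) 𝓘(ℝ, V') ∞ g) :
    IsLocallyDecomposableAlong V (g ∘ q) fun x =>
      exteriorPower.map k (mfderiv 𝓘(ℝ, B) 𝓘(ℝ, V') g (q x)).toLinearMap (W x) := fun x₀ => by
  obtain ⟨U, hU, hx₀, Y, hY, hWY⟩ := hW x₀
  refine ⟨U, hU, hx₀, _, fun i => (hY i).mfderiv hg, fun x hx => ?_⟩
  simp only [hWY x hx, exteriorPower.map_apply_ιMulti]
  rfl

end Functoriality

section Coefficients

variable {ι : Type*} [Fintype ι] [FiniteDimensional ℝ B]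

theorem contMDiffAt_coeff_of_sum_smul {z : ι → N → B} {c : N → ι → ℝ} {x₀ : N}
    (hz : ∀ i, ContMDiffAt 𝓘(ℝ, V) 𝓘(ℝ, B) ∞ (z i) x₀)
    (hli : LinearIndependent ℝ fun i => z i x₀)
    (hw : ContMDiffAt 𝓘(ℝ, V) 𝓘(ℝ, B) ∞ (fun x => ∑ i, c x i • z i x) x₀) :
    ContMDiffAt 𝓘(ℝ, V) 𝓘(ℝ, ι → ℝ) ∞ c x₀ := by
  let A : N → (ι → ℝ) →L[ℝ] B := fun x =>
    ∑ i, ContinuousLinearMap.smulRightL ℝ (ι → ℝ) B (ContinuousLinearMap.proj i) (z i x)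
  have hA_apply (x : N) (a : ι → ℝ) : A x a = ∑ i, a i • z i x := by simp [A]
  have hA : ContMDiffAt 𝓘(ℝ, V) 𝓘(ℝ, (ι → ℝ) →L[ℝ] B) ∞ A x₀ :=
    contMDiffAt_finsetSum fun i _ =>
      (ContinuousLinearMap.contMDiff _).contMDiffAt.comp x₀ (hz i)
  have hinj : Function.Injective (A x₀) := fun a b hab => by
    simp only [hA_apply] at hab
    exact hli.fintypeLinearCombination_injective hab
  obtain ⟨l, hl⟩ :=
    (A x₀).toLinearMap.exists_leftInverse_of_injective (LinearMap.ker_eq_bot.2 hinj)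
  let P : B →L[ℝ] (ι → ℝ) := LinearMap.toContinuousLinearMap l
  have hPA : ContMDiffAt 𝓘(ℝ, V) 𝓘(ℝ, (ι → ℝ) →L[ℝ] (ι → ℝ)) ∞ (fun x => P.comp (A x)) x₀ :=
    contMDiffAt_const.clm_comp hA
  have hPA₀ : P.comp (A x₀) = ContinuousLinearEquiv.refl ℝ (ι → ℝ) :=
    ContinuousLinearMap.ext fun a => LinearMap.congr_fun hl a
  have hinv : ∀ᶠ x in nhds x₀, (P.comp (A x)).IsInvertible :=
    hPA.continuousAt.eventually (hPA₀.symm ▸ ContinuousLinearEquiv.nhds _ :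
      ∀ᶠ L in nhds (P.comp (A x₀)), L.IsInvertible)
  have hPA_inv : ContMDiffAt 𝓘(ℝ, V) 𝓘(ℝ, (ι → ℝ) →L[ℝ] (ι → ℝ)) ∞
      (fun x => (P.comp (A x)).inverse) x₀ :=
    hinv.self_of_nhds.contDiffAt_map_inverse.contMDiffAt.comp x₀ hPA
  refine (hPA_inv.clm_apply (P.contMDiff.contMDiffAt.comp x₀ hw)).congr_of_eventuallyEq ?_
  filter_upwards [hinv] with x hx
  rw [Function.comp_apply, ← hA_apply, ← ContinuousLinearMap.comp_apply P (A x),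
    hx.inverse_apply_self]

theorem IsSmoothVectorFieldAlongOn.contMDiffOn_coeff {q : N → M} {U : Set N} (hU : IsOpen U)
    {Z : ι → ∀ x : N, TangentSpace 𝓘(ℝ, B) (q x)}
    (hZ : ∀ i, IsSmoothVectorFieldAlongOn V q (Z i) U)
    (hli : ∀ x ∈ U, LinearIndependent ℝ fun i => Z i x) {c : N → ι → ℝ}
    (hsum : IsSmoothVectorFieldAlongOn V q (fun x => ∑ i, c x i • Z i x) U) :
    ContMDiffOn 𝓘(ℝ, V) 𝓘(ℝ, ι → ℝ) ∞ c U := fun x₀ hx₀ => by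
  let T := trivializationAt B (TangentSpace 𝓘(ℝ, B) : M → Type _) (q x₀)
  have hsum₀ := Bundle.contMDiffAt_totalSpace.1 (hsum.contMDiffAt (hU.mem_nhds hx₀))
  have hbase : ∀ᶠ x in nhds x₀, q x ∈ T.baseSet :=
    hsum₀.1.continuousAt.eventually
      (T.open_baseSet.mem_nhds (FiberBundle.mem_baseSet_trivializationAt' (q x₀)))
  let ℓ : ∀ x : N, TangentSpace 𝓘(ℝ, B) (q x) →L[ℝ] B := fun x => T.continuousLinearMapAt ℝ (q x)
  have hℓ : ∀ x, q x ∈ T.baseSet → ∀ w : TangentSpace 𝓘(ℝ, B) (q x), (T ⟨q x, w⟩).2 = ℓ x w :=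
    fun x hx w => by simp [ℓ, T.coe_linearMapAt_of_mem hx]
  have hℓinj : LinearMap.ker (ℓ x₀).toLinearMap = ⊥ := by
    refine LinearMap.ker_eq_bot.2 fun v w hvw => ?_
    refine (T.continuousLinearEquivAt ℝ (q x₀) hbase.self_of_nhds).injective ?_
    exact ((hℓ x₀ hbase.self_of_nhds v).trans hvw).trans (hℓ x₀ hbase.self_of_nhds w).symm
  refine (contMDiffAt_coeff_of_sum_smul (z := fun i x => ℓ x (Z i x)) (fun i => ?_)
    ((hli x₀ hx₀).map' _ hℓinj) ?_).contMDiffWithinAt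
  · refine (Bundle.contMDiffAt_totalSpace.1
      ((hZ i).contMDiffAt (hU.mem_nhds hx₀))).2.congr_of_eventuallyEq ?_
    filter_upwards [hbase] with x hx using (hℓ x hx _).symm
  · refine hsum₀.2.congr_of_eventuallyEq ?_
    filter_upwards [hbase] with x hx
    simp only [← map_smul, ← map_sum]
    exact (hℓ x hx _).symm

end Coefficients

end FieldsAlong

section Lifts

variable {V N B M : Type*} [NormedAddCommGroup V] [NormedSpace ℝ V] [TopologicalSpace N]
  [ChartedSpace V N] [IsManifold 𝓘(ℝ, V) ∞ N] [NormedAddCommGroup B] [NormedSpace ℝ B]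
  [TopologicalSpace M] [ChartedSpace B M] {k : ℕ}

namespace TangentDistribution

theorem nonempty_basis_space (D : TangentDistribution V N k) (x : N) :
    Nonempty (Module.Basis (Fin k) ℝ (D.space x)) := by
  obtain ⟨U, -, hx, X, -, hX⟩ := D.exists_frame x
  obtain ⟨hli, hspan⟩ := hX x hx
  exact ⟨(Module.Basis.span hli).map (LinearEquiv.ofEq _ _ hspan)⟩

theorem finrank_space (D : TangentDistribution V N k) (x : N) :
    Module.finrank ℝ (D.space x) = k := by
  obtain ⟨b⟩ := D.nonempty_basis_space x
  rw [Module.finrank_eq_card_basis b, Fintype.card_fin]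

instance finiteDimensional_space (D : TangentDistribution V N k) (x : N) :
    FiniteDimensional ℝ (D.space x) := by
  obtain ⟨b⟩ := D.nonempty_basis_space x
  exact Module.Finite.of_basis b

theorem IsTransverse.injOn {D : TangentDistribution V N k} {q : N → M}
    (h : D.IsTransverse (B := B) q) (x : N) :
    InjOn (mfderiv 𝓘(ℝ, V) 𝓘(ℝ, B) q x) (D.space x : Set (TangentSpace 𝓘(ℝ, V) x)) :=
  LinearMap.injOn_of_disjoint_ker le_rfl (h x).disjoint

section Smoothness

variable [FiniteDimensional ℝ B]

theorem IsTransverse.exists_lift {D : TangentDistribution V N k} {q : N → M}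
    (h : D.IsTransverse (B := B) q) (hk : Module.finrank ℝ B = k) (x : N) :
    ∃ l : TangentSpace 𝓘(ℝ, B) (q x) →ₗ[ℝ] TangentSpace 𝓘(ℝ, V) x,
      (∀ w, l w ∈ D.space x) ∧
        (mfderiv 𝓘(ℝ, V) 𝓘(ℝ, B) q x).toLinearMap ∘ₗ l = LinearMap.id := by
  let f : D.space x →ₗ[ℝ] TangentSpace 𝓘(ℝ, B) (q x) :=
    (mfderiv 𝓘(ℝ, V) 𝓘(ℝ, B) q x).toLinearMap.domRestrict (D.space x)
  have hf : Function.Injective f := LinearMap.injective_domRestrict_iff.2 (h x).disjoint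
  have hdim : Module.finrank ℝ (D.space x) = Module.finrank ℝ (TangentSpace 𝓘(ℝ, B) (q x)) :=
    (D.finrank_space x).trans hk.symm
  let e := LinearEquiv.ofInjectiveOfFinrankEq f hf hdim
  exact ⟨(D.space x).subtype ∘ₗ e.symm.toLinearMap, fun w => (e.symm w).2,
    LinearMap.ext fun w => e.apply_symm_apply w⟩

variable [IsManifold 𝓘(ℝ, B) ∞ M]

theorem IsTransverse.isSmoothVectorFieldOn_of_mfderiv {D : TangentDistribution V N k} {q : N → M}
    (h : D.IsTransverse (B := B) q) (hq : ContMDiff 𝓘(ℝ, V) 𝓘(ℝ, B) ∞ q) {U : Set N}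
    (hU : IsOpen U) {Y : ∀ x : N, TangentSpace 𝓘(ℝ, V) x} (hYD : ∀ x ∈ U, Y x ∈ D.space x)
    (hqY : IsSmoothVectorFieldAlongOn V q (fun x => mfderiv 𝓘(ℝ, V) 𝓘(ℝ, B) q x (Y x)) U) :
    IsSmoothVectorFieldOn Y U := fun x₀ hx₀ => by
  obtain ⟨U', hU', hx₀', X, hX, hXD⟩ := D.exists_frame x₀
  have hO : IsOpen (U ∩ U') := hU.inter hU'
  have hcoeff : ∀ x ∈ U ∩ U', ∃ a : Fin k → ℝ, ∑ i, a i • X i x = Y x := fun x hx => by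
    rw [← Submodule.mem_span_range_iff_exists_fun, (hXD x hx.2).2]
    exact hYD x hx.1
  choose! c hc using hcoeff
  have hXO : ∀ i, IsSmoothVectorFieldOn (X i) (U ∩ U') := fun i => (hX i).mono inter_subset_right
  have hqX : ∀ i, IsSmoothVectorFieldAlongOn V q
      (fun x => mfderiv 𝓘(ℝ, V) 𝓘(ℝ, B) q x (X i x)) (U ∩ U') := fun i =>
    IsSmoothVectorFieldAlongOn.mfderiv (q := id) (hXO i) hq
  have hli : ∀ x ∈ U ∩ U',
      LinearIndependent ℝ fun i => mfderiv 𝓘(ℝ, V) 𝓘(ℝ, B) q x (X i x) := fun x hx => by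
    refine (hXD x hx.2).1.map (f := (mfderiv 𝓘(ℝ, V) 𝓘(ℝ, B) q x).toLinearMap) ?_
    rw [(hXD x hx.2).2]
    exact (h x).disjoint
  have hsum : IsSmoothVectorFieldAlongOn V q
      (fun x => ∑ i, c x i • mfderiv 𝓘(ℝ, V) 𝓘(ℝ, B) q x (X i x)) (U ∩ U') := by
    refine (hqY.mono inter_subset_left).congr fun x hx => ?_
    simp only [← hc x hx, map_sum, map_smul]
  have hc_smooth := IsSmoothVectorFieldAlongOn.contMDiffOn_coeff hO hqX hli hsum
  have hcX : IsSmoothVectorFieldOn (fun x => ∑ i, c x i • X i x) (U ∩ U') :=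
    ContMDiffOn.sum_section fun i _ => (contMDiffOn_pi_space.1 hc_smooth i).smul_section (hXO i)
  have hY : IsSmoothVectorFieldOn Y (U ∩ U') := hcX.congr fun x hx => by rw [← hc x hx]
  exact (hY.contMDiffAt (hO.mem_nhds ⟨hx₀, hx₀'⟩)).contMDiffWithinAt

theorem IsTransverse.exists_mem_multivectorClass_map_eq {D : TangentDistribution V N k} {q : N → M}
    (h : D.IsTransverse (B := B) q) (hq : ContMDiff 𝓘(ℝ, V) 𝓘(ℝ, B) ∞ q)
    (hk : Module.finrank ℝ B = k) {W : ∀ x : N, ⋀[ℝ]^k (TangentSpace 𝓘(ℝ, B) (q x))}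
    (hW0 : ∀ x, W x ≠ 0) (hW : IsLocallyDecomposableAlong V q W) :
    ∃ X ∈ D.multivectorClass, ∀ x,
      exteriorPower.map k (mfderiv 𝓘(ℝ, V) 𝓘(ℝ, B) q x).toLinearMap (X x) = W x := by
  choose l hlD hl using h.exists_lift hk
  have hmap : ∀ x, exteriorPower.map k (mfderiv 𝓘(ℝ, V) 𝓘(ℝ, B) q x).toLinearMap
      (exteriorPower.map k (l x) (W x)) = W x := fun x => by
    rw [← LinearMap.comp_apply, ← exteriorPower.map_comp, hl, exteriorPower.map_id,
      LinearMap.id_apply]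
  refine ⟨fun x => exteriorPower.map k (l x) (W x), ⟨fun x h0 => hW0 x ?_, fun x₀ => ?_,
    fun x => ?_⟩, hmap⟩
  · exact (hmap x).symm.trans ((congrArg _ h0).trans (map_zero _))
  · obtain ⟨U, hU, hx₀, Y, hY, hWY⟩ := hW x₀
    refine ⟨U, hU, hx₀, fun i x => l x (Y i x), fun i => ?_, fun x hx => ?_⟩
    · refine h.isSmoothVectorFieldOn_of_mfderiv hq hU (fun x _ => hlD x _) ?_
      refine (hY i).congr fun x _ => ?_
      exact congrArg (Bundle.TotalSpace.mk (q x)) (LinearMap.congr_fun (hl x) (Y i x))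
    · simp only [hWY x hx, exteriorPower.map_apply_ιMulti]
      rfl
  · exact map_mem_kVectors (LinearMap.map_le_range.trans (LinearMap.range_le_iff_comap.2
      (Submodule.eq_top_iff'.2 (hlD x)))) (mem_kVectors_top (W x))

end Smoothness

end TangentDistribution

end Lifts

section Related

variable {V N V' N' B M : Type*} [NormedAddCommGroup V] [NormedSpace ℝ V] [TopologicalSpace N]
  [ChartedSpace V N] [NormedAddCommGroup V'] [NormedSpace ℝ V']
  [TopologicalSpace N'] [ChartedSpace V' N'] [NormedAddCommGroup B]
  [NormedSpace ℝ B] [TopologicalSpace M] [ChartedSpace B M] {k : ℕ}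
  {Ψ : N → N'}

theorem exteriorPower_map_mfderiv_comp {q : N' → M} {x : N}
    (hq : MDifferentiableAt 𝓘(ℝ, V') 𝓘(ℝ, B) q (Ψ x))
    (hΨ : MDifferentiableAt 𝓘(ℝ, V) 𝓘(ℝ, V') Ψ x) (ξ : ⋀[ℝ]^k (TangentSpace 𝓘(ℝ, V) x)) :
    exteriorPower.map k (mfderiv 𝓘(ℝ, V) 𝓘(ℝ, B) (q ∘ Ψ) x).toLinearMap ξ =
      exteriorPower.map k (mfderiv 𝓘(ℝ, V') 𝓘(ℝ, B) q (Ψ x)).toLinearMap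
        (exteriorPower.map k (mfderiv 𝓘(ℝ, V) 𝓘(ℝ, V') Ψ x).toLinearMap ξ) := by
  rw [mfderiv_comp x hq hΨ, ← LinearMap.comp_apply, ← exteriorPower.map_comp]
  rfl

theorem exteriorPower_map_mfderiv_of_eq_id {f : N → N} (hf : f = id)
    (X : ∀ x : N, ⋀[ℝ]^k (TangentSpace 𝓘(ℝ, V) x)) (x : N) :
    exteriorPower.map k (mfderiv 𝓘(ℝ, V) 𝓘(ℝ, V) f x).toLinearMap (X x) = X (f x) := by
  subst hf
  rw [mfderiv_id]
  exact LinearMap.congr_fun exteriorPower.map_id (X x)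

variable [IsManifold 𝓘(ℝ, V) ∞ N] [IsManifold 𝓘(ℝ, V') ∞ N'] {D : TangentDistribution V N k}
  {D' : TangentDistribution V' N' k}

namespace TangentDistribution

theorem IsRelated.map_space_eq (h : IsRelated Ψ D D') (hne : D'.multivectorClass.Nonempty)
    (x : N) : (D.space x).map (mfderiv 𝓘(ℝ, V) 𝓘(ℝ, V') Ψ x).toLinearMap = D'.space (Ψ x) := by
  obtain ⟨X', hX'⟩ := hne
  obtain ⟨X, hX, hXX'⟩ := h.1 X' hX'
  exact map_eq_of_map_mem_kVectors (D.finrank_space x) (D'.finrank_space (Ψ x)) (hX.2.2 x)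
    (hXX' x ▸ hX'.2.2 (Ψ x)) (hXX' x ▸ hX'.1 (Ψ x))

theorem IsTransverse.exteriorPower_map_mfderiv_ne_zero {q : N → M}
    (h : D.IsTransverse (B := B) q) {X : ∀ x : N, ⋀[ℝ]^k (TangentSpace 𝓘(ℝ, V) x)}
    (hX : X ∈ D.multivectorClass) (x : N) :
    exteriorPower.map k (mfderiv 𝓘(ℝ, V) 𝓘(ℝ, B) q x).toLinearMap (X x) ≠ 0 := fun h0 =>
  hX.1 x (map_injOn_kVectors (h x).disjoint (hX.2.2 x) (Submodule.zero_mem _)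
    (h0.trans (map_zero _).symm))

variable [FiniteDimensional ℝ B] [IsManifold 𝓘(ℝ, B) ∞ M]

theorem exists_related_of_map_space_le {q : N' → M}
    (hD : D.IsTransverse (B := B) (q ∘ Ψ)) (hD' : D'.IsTransverse (B := B) q)
    (hq : ContMDiff 𝓘(ℝ, V') 𝓘(ℝ, B) ∞ q) (hΨ : ContMDiff 𝓘(ℝ, V) 𝓘(ℝ, V') ∞ Ψ)
    (hk : Module.finrank ℝ B = k)
    (hDD' : ∀ x, (D.space x).map (mfderiv 𝓘(ℝ, V) 𝓘(ℝ, V') Ψ x).toLinearMap ≤ D'.space (Ψ x))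
    {X' : ∀ y : N', ⋀[ℝ]^k (TangentSpace 𝓘(ℝ, V') y)} (hX' : X' ∈ D'.multivectorClass) :
    ∃ X ∈ D.multivectorClass, ∀ x,
      X' (Ψ x) = exteriorPower.map k (mfderiv 𝓘(ℝ, V) 𝓘(ℝ, V') Ψ x).toLinearMap (X x) := by
  have hqX' : IsLocallyDecomposableAlong V' (q ∘ id) fun y =>
      exteriorPower.map k (mfderiv 𝓘(ℝ, V') 𝓘(ℝ, B) q y).toLinearMap (X' y) :=
    IsLocallyDecomposableAlong.map_mfderiv (q := id) hX'.2.1 hq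
  obtain ⟨X, hX, hqX⟩ := hD.exists_mem_multivectorClass_map_eq (hq.comp hΨ) hk
    (fun x => hD'.exteriorPower_map_mfderiv_ne_zero hX' (Ψ x)) (hqX'.comp hΨ)
  refine ⟨X, hX, fun x => map_injOn_kVectors (hD' (Ψ x)).disjoint (hX'.2.2 (Ψ x))
    (map_mem_kVectors (hDD' x) (hX.2.2 x)) ?_⟩
  rw [← exteriorPower_map_mfderiv_comp (hq.mdifferentiable (by simp) _)
    (hΨ.mdifferentiable (by simp) _)]
  exact (hqX x).symm

theorem exists_related_of_leftInverse {q : N → M} {r : N' → N}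
    (hD : D.IsTransverse (B := B) q) (hD' : D'.IsTransverse (B := B) (q ∘ r))
    (hq : ContMDiff 𝓘(ℝ, V) 𝓘(ℝ, B) ∞ q) (hr : ContMDiff 𝓘(ℝ, V') 𝓘(ℝ, V) ∞ r)
    (hΨ : ContMDiff 𝓘(ℝ, V) 𝓘(ℝ, V') ∞ Ψ) (hrΨ : r ∘ Ψ = id)
    (hk : Module.finrank ℝ B = k)
    (hDD' : ∀ x, (D.space x).map (mfderiv 𝓘(ℝ, V) 𝓘(ℝ, V') Ψ x).toLinearMap ≤ D'.space (Ψ x))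
    {X : ∀ x : N, ⋀[ℝ]^k (TangentSpace 𝓘(ℝ, V) x)} (hX : X ∈ D.multivectorClass) :
    ∃ X' ∈ D'.multivectorClass, ∀ x,
      X' (Ψ x) = exteriorPower.map k (mfderiv 𝓘(ℝ, V) 𝓘(ℝ, V') Ψ x).toLinearMap (X x) := by
  have hqX : IsLocallyDecomposableAlong V (q ∘ id) fun x =>
      exteriorPower.map k (mfderiv 𝓘(ℝ, V) 𝓘(ℝ, B) q x).toLinearMap (X x) :=
    IsLocallyDecomposableAlong.map_mfderiv (q := id) hX.2.1 hq
  obtain ⟨X', hX', hqX'⟩ := hD'.exists_mem_multivectorClass_map_eq (hq.comp hr) hk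
    (fun y => hD.exteriorPower_map_mfderiv_ne_zero hX (r y)) (hqX.comp hr)
  refine ⟨X', hX', fun x => map_injOn_kVectors (hD' (Ψ x)).disjoint (hX'.2.2 (Ψ x))
    (map_mem_kVectors (hDD' x) (hX.2.2 x)) ?_⟩
  have hr' := hr.mdifferentiable (by simp) (Ψ x)
  have hΨ' := hΨ.mdifferentiable (by simp) x
  have hrΨX : exteriorPower.map k (mfderiv 𝓘(ℝ, V') 𝓘(ℝ, V) r (Ψ x)).toLinearMap
      (exteriorPower.map k (mfderiv 𝓘(ℝ, V) 𝓘(ℝ, V') Ψ x).toLinearMap (X x)) = X (r (Ψ x)) := by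
    rw [← exteriorPower_map_mfderiv_comp hr' hΨ']
    exact exteriorPower_map_mfderiv_of_eq_id hrΨ X x
  rw [hqX', exteriorPower_map_mfderiv_comp (hq.mdifferentiable (by simp) _) hr', hrΨX]

theorem isRelated_of_map_space_eq {q : N → M} {r : N' → N}
    (hD : D.IsTransverse (B := B) q) (hD' : D'.IsTransverse (B := B) (q ∘ r))
    (hq : ContMDiff 𝓘(ℝ, V) 𝓘(ℝ, B) ∞ q) (hr : ContMDiff 𝓘(ℝ, V') 𝓘(ℝ, V) ∞ r)
    (hΨ : ContMDiff 𝓘(ℝ, V) 𝓘(ℝ, V') ∞ Ψ) (hrΨ : r ∘ Ψ = id)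
    (hk : Module.finrank ℝ B = k)
    (hDD' : ∀ x, (D.space x).map (mfderiv 𝓘(ℝ, V) 𝓘(ℝ, V') Ψ x).toLinearMap = D'.space (Ψ x)) :
    IsRelated Ψ D D' := by
  have hD_comp : D.IsTransverse (B := B) ((q ∘ r) ∘ Ψ) := by
    rwa [Function.comp_assoc, hrΨ, Function.comp_id]
  exact ⟨
    fun _ => exists_related_of_map_space_le hD_comp hD' (hq.comp hr) hΨ hk fun x => (hDD' x).le,
    fun _ => exists_related_of_leftInverse hD hD' hq hr hΨ hrΨ hk fun x => (hDD' x).le⟩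

end TangentDistribution

end Related

section IntegralSections

variable {V N B M : Type*} [NormedAddCommGroup V] [NormedSpace ℝ V] [TopologicalSpace N]
  [ChartedSpace V N] [NormedAddCommGroup B] [NormedSpace ℝ B] [TopologicalSpace M]
  [ChartedSpace B M] {k : ℕ}

theorem IsLocalSection.mdifferentiableAt {q : N → M} {U : Set M} {γ : M → N}
    (hγ : IsLocalSection (B := B) (V := V) q U γ) {x : M} (hx : x ∈ U) :
    MDifferentiableAt 𝓘(ℝ, B) 𝓘(ℝ, V) γ x :=
  (hγ.contMDiffOn.contMDiffAt (hγ.isOpen.mem_nhds hx)).mdifferentiableAt (by simp)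

theorem IsLocalSection.mfderiv_proj_mfderiv {q : N → M} (hq : ContMDiff 𝓘(ℝ, V) 𝓘(ℝ, B) ∞ q)
    {U : Set M} {γ : M → N} (hγ : IsLocalSection (B := B) (V := V) q U γ) {x : M} (hx : x ∈ U)
    (v : TangentSpace 𝓘(ℝ, B) x) :
    mfderiv 𝓘(ℝ, V) 𝓘(ℝ, B) q (γ x) (mfderiv 𝓘(ℝ, B) 𝓘(ℝ, V) γ x v) = v := by
  have hcomp : HasMFDerivAt 𝓘(ℝ, B) 𝓘(ℝ, B) (q ∘ γ) x
      ((mfderiv 𝓘(ℝ, V) 𝓘(ℝ, B) q (γ x)).comp (mfderiv 𝓘(ℝ, B) 𝓘(ℝ, V) γ x)) :=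
    HasMFDerivAt.comp x (hq.mdifferentiable (by simp) _).hasMFDerivAt
      (hγ.mdifferentiableAt hx).hasMFDerivAt
  have hid : q ∘ γ =ᶠ[nhds x] id :=
    Filter.eventuallyEq_of_mem (hγ.isOpen.mem_nhds hx) hγ.proj_apply
  exact DFunLike.congr_fun
    (hasMFDerivAt_unique hcomp ((hasMFDerivAt_id x).congr_of_eventuallyEq hid)) v

theorem exists_contDiffOn_rightInverse_of_bijective_fderiv [CompleteSpace V] [CompleteSpace B]
    {g : V → B} {U : Set V} (hU : IsOpen U) (hg : ContDiffOn ℝ ∞ g U)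
    (hbij : ∀ t ∈ U, Function.Bijective (fderiv ℝ g t)) {t₀ : V} (ht₀ : t₀ ∈ U) :
    ∃ (O : Set B) (τ : B → V), IsOpen O ∧ ContDiffOn ℝ ∞ τ O ∧ MapsTo τ O U ∧
      (∀ y ∈ O, g (τ y) = y) ∧ g t₀ ∈ O ∧ τ (g t₀) = t₀ := by
  have hg_at : ∀ t ∈ U, ContDiffAt ℝ ∞ g t := fun t ht => hg.contDiffAt (hU.mem_nhds ht)
  have hderiv : ∀ t ∈ U, ∃ e : V ≃L[ℝ] B, HasFDerivAt g (e : V →L[ℝ] B) t := fun t ht =>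
    ⟨.ofBijective (fderiv ℝ g t) (LinearMap.ker_eq_bot.2 (hbij t ht).1)
      (LinearMap.range_eq_top.2 (hbij t ht).2),
      ((hg_at t ht).differentiableAt (by simp)).hasFDerivAt⟩
  obtain ⟨e₀, he₀⟩ := hderiv t₀ ht₀
  let H := (hg_at t₀ ht₀).toOpenPartialHomeomorph g he₀ (by simp)
  have ht₀H : t₀ ∈ H.source := (hg_at t₀ ht₀).mem_toOpenPartialHomeomorph_source he₀ (by simp)
  have hHt₀ : H.symm (g t₀) = t₀ := H.left_inv ht₀H
  refine ⟨H.target ∩ H.symm ⁻¹' U, H.symm, H.isOpen_inter_preimage_symm hU, fun y hy => ?_,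
    fun y hy => hy.2, fun y hy => H.right_inv hy.1, ⟨H.map_source ht₀H, ?_⟩, hHt₀⟩
  · obtain ⟨e, he⟩ := hderiv _ hy.2
    exact (H.contDiffAt_symm hy.1 he (hg_at _ hy.2)).contDiffWithinAt
  · exact mem_preimage.2 (hHt₀.symm ▸ ht₀)

theorem exists_isLocalSection_of_bijective_mfderiv [CompleteSpace V] [CompleteSpace B]
    [IsManifold 𝓘(ℝ, B) ∞ M] {g : V → M} {U : Set V} (hU : IsOpen U)
    (hg : ContMDiffOn 𝓘(ℝ, V) 𝓘(ℝ, B) ∞ g U)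
    (hbij : ∀ t ∈ U, Function.Bijective (mfderiv 𝓘(ℝ, V) 𝓘(ℝ, B) g t)) {t₀ : V} (ht₀ : t₀ ∈ U) :
    ∃ (O : Set M) (τ : M → V), IsLocalSection (B := B) (V := V) g O τ ∧ MapsTo τ O U ∧
      g t₀ ∈ O ∧ τ (g t₀) = t₀ := by
  let c := chartAt B (g t₀)
  let U₁ := U ∩ g ⁻¹' c.source
  have hU₁ : IsOpen U₁ := hg.continuousOn.isOpen_inter_preimage hU c.open_source
  have hc : ContMDiffOn 𝓘(ℝ, B) 𝓘(ℝ, B) ∞ c c.source := contMDiffOn_chart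
  have hcg : ContDiffOn ℝ ∞ (c ∘ g) U₁ :=
    contMDiffOn_iff_contDiffOn.1 (hc.comp (hg.mono inter_subset_left) fun _ hs => hs.2)
  have hcg_bij : ∀ t ∈ U₁, Function.Bijective (fderiv ℝ (c ∘ g) t) := fun t ht => by
    rw [← mfderiv_eq_fderiv, mfderiv_comp t
      ((hc.contMDiffAt (c.open_source.mem_nhds ht.2)).mdifferentiableAt (by simp))
      ((hg.contMDiffAt (hU.mem_nhds ht.1)).mdifferentiableAt (by simp))]
    exact ((mdifferentiable_chart (I := 𝓘(ℝ, B)) (g t₀)).mfderiv ht.2).bijective.comp (hbij t ht.1)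
  obtain ⟨O, τ, hO, hτ, hτU, hcgτ, ht₀O, hτt₀⟩ :=
    exists_contDiffOn_rightInverse_of_bijective_fderiv hU₁ hcg hcg_bij ⟨ht₀, mem_chart_source B _⟩
  refine ⟨c.source ∩ c ⁻¹' O, τ ∘ c, ⟨c.isOpen_inter_preimage hO,
    hτ.contMDiffOn.comp (hc.mono inter_subset_left) fun x hx => hx.2, fun x hx => ?_⟩,
    fun x hx => (hτU hx.2).1, ⟨mem_chart_source B _, ht₀O⟩, hτt₀⟩
  exact c.injOn (hτU hx.2).2 hx.1 (hcgτ _ hx.2)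

namespace TangentDistribution

variable [IsManifold 𝓘(ℝ, V) ∞ N] {D : TangentDistribution V N k} {q : N → M}

theorem isIntegralSectionOn_of_range_le
    (hq : ContMDiff 𝓘(ℝ, V) 𝓘(ℝ, B) ∞ q) (hk : Module.finrank ℝ B = k) {U : Set M} {γ : M → N}
    (hγ : IsLocalSection (B := B) (V := V) q U γ)
    (hle : ∀ x ∈ U, (mfderiv 𝓘(ℝ, B) 𝓘(ℝ, V) γ x).range ≤ D.space (γ x)) :
    D.IsIntegralSectionOn (B := B) U γ := fun x hx => by
  refine Submodule.eq_of_le_of_finrank_eq (hle x hx) ?_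
  rw [D.finrank_space, ← hk]
  exact LinearMap.finrank_range_of_inj (f := (mfderiv 𝓘(ℝ, B) 𝓘(ℝ, V) γ x).toLinearMap)
    (Function.LeftInverse.injective (hγ.mfderiv_proj_mfderiv hq hx))

theorem IsIntegrable.exists_isIntegralSectionOn [FiniteDimensional ℝ B] [IsManifold 𝓘(ℝ, B) ∞ M]
    (hD : D.IsIntegrable) (hq : ContMDiff 𝓘(ℝ, V) 𝓘(ℝ, B) ∞ q)
    (htr : D.IsTransverse (B := B) q) (hk : Module.finrank ℝ B = k) (u : N) :
    ∃ (U : Set M) (γ : M → N), IsLocalSection (B := B) (V := V) q U γ ∧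
      D.IsIntegralSectionOn (B := B) U γ ∧ ∃ x ∈ U, γ x = u := by
  obtain ⟨O, f, hO, h0, rfl, hf, hfD⟩ := hD u
  have hf_mdiff : ∀ t ∈ O, MDifferentiableAt 𝓘(ℝ, EuclideanSpace ℝ (Fin k)) 𝓘(ℝ, V) f t :=
    fun t ht => (hf.contMDiffAt (hO.mem_nhds ht)).mdifferentiableAt (by simp)
  have hbij : ∀ t ∈ O, Function.Bijective
      (mfderiv 𝓘(ℝ, EuclideanSpace ℝ (Fin k)) 𝓘(ℝ, B) (q ∘ f) t) := fun t ht => by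
    obtain ⟨hf_inj, hf_range⟩ := hfD t ht
    have hmem : ∀ v, mfderiv 𝓘(ℝ, EuclideanSpace ℝ (Fin k)) 𝓘(ℝ, V) f t v ∈ D.space (f t) :=
      fun v => hf_range ▸ LinearMap.mem_range_self _ v
    have hinj : Function.Injective
        (mfderiv 𝓘(ℝ, EuclideanSpace ℝ (Fin k)) 𝓘(ℝ, B) (q ∘ f) t).toLinearMap := by
      rw [mfderiv_comp t (hq.mdifferentiable (by simp) _) (hf_mdiff t ht)]
      exact fun v w hvw => hf_inj (htr.injOn (f t) (hmem v) (hmem w) hvw)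
    exact ⟨hinj, (LinearMap.injective_iff_surjective_of_finrank_eq_finrank
      (finrank_euclideanSpace_fin.trans hk.symm)).1 hinj⟩
  obtain ⟨U, τ, hτ, hτO, h0U, hτ0⟩ :=
    exists_isLocalSection_of_bijective_mfderiv hO (hq.comp_contMDiffOn hf) hbij h0
  have hfτ : IsLocalSection (B := B) (V := V) q U (f ∘ τ) :=
    ⟨hτ.isOpen, hf.comp hτ.contMDiffOn hτO, hτ.proj_apply⟩
  refine ⟨U, f ∘ τ, hfτ, isIntegralSectionOn_of_range_le hq hk hfτ fun x hx => ?_, q (f 0), h0U,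
    congrArg f hτ0⟩
  rw [mfderiv_comp x (hf_mdiff _ (hτO hx)) (hτ.mdifferentiableAt hx)]
  exact (LinearMap.range_comp_le_range _ _).trans (hfD _ (hτO hx)).2.le

variable {V' N' : Type*} [NormedAddCommGroup V'] [NormedSpace ℝ V'] [TopologicalSpace N']
  [ChartedSpace V' N'] {Ψ : N → N'}

theorem IsIntegralSectionOn.range_mfderiv_comp {U : Set M} {γ : M → N}
    (hγD : D.IsIntegralSectionOn (B := B) U γ) (hγ : IsLocalSection (B := B) (V := V) q U γ)
    (hΨ : ContMDiff 𝓘(ℝ, V) 𝓘(ℝ, V') ∞ Ψ) {x : M} (hx : x ∈ U) :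
    (mfderiv 𝓘(ℝ, B) 𝓘(ℝ, V') (Ψ ∘ γ) x).range =
      (D.space (γ x)).map (mfderiv 𝓘(ℝ, V) 𝓘(ℝ, V') Ψ (γ x)).toLinearMap := by
  rw [mfderiv_comp x (hΨ.mdifferentiable (by simp) _) (hγ.mdifferentiableAt hx), ← hγD x hx]
  exact LinearMap.range_comp _ _

theorem IsIntegrable.forall_isIntegralSectionOn_comp_iff [FiniteDimensional ℝ B]
    [IsManifold 𝓘(ℝ, B) ∞ M] [IsManifold 𝓘(ℝ, V') ∞ N'] {D' : TangentDistribution V' N' k}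
    (hD : D.IsIntegrable) (hq : ContMDiff 𝓘(ℝ, V) 𝓘(ℝ, B) ∞ q)
    (htr : D.IsTransverse (B := B) q) (hk : Module.finrank ℝ B = k)
    (hΨ : ContMDiff 𝓘(ℝ, V) 𝓘(ℝ, V') ∞ Ψ) :
    (∀ (U : Set M) (γ : M → N), IsLocalSection (B := B) (V := V) q U γ →
      D.IsIntegralSectionOn (B := B) U γ → D'.IsIntegralSectionOn (B := B) U (Ψ ∘ γ)) ↔
      ∀ x, (D.space x).map (mfderiv 𝓘(ℝ, V) 𝓘(ℝ, V') Ψ x).toLinearMap = D'.space (Ψ x) := by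
  refine ⟨fun h u => ?_, fun h U γ hγ hγD x hx =>
    (hγD.range_mfderiv_comp hγ hΨ hx).trans (h (γ x))⟩
  obtain ⟨U, γ, hγ, hγD, x, hx, rfl⟩ := hD.exists_isIntegralSectionOn hq htr hk u
  exact (hγD.range_mfderiv_comp hγ hΨ hx).symm.trans (h U γ hγ hγD x hx)

end TangentDistribution

end IntegralSections

section VolumeForm

variable {B M : Type*} [NormedAddCommGroup B] [NormedSpace ℝ B]
  [TopologicalSpace M] [ChartedSpace B M] {m : ℕ}

theorem IsVolumeForm.alternatingMapLinearEquiv_bijective [FiniteDimensional ℝ B]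
    {η : ∀ x : M, TangentSpace 𝓘(ℝ, B) x [⋀^Fin m]→L[ℝ] ℝ} (hη : IsVolumeForm η)
    (hm : Module.finrank ℝ B = m) (x : M) :
    Function.Bijective (exteriorPower.alternatingMapLinearEquiv (η x).toAlternatingMap) := by
  have hmx : Module.finrank ℝ (TangentSpace 𝓘(ℝ, B) x) = m := hm
  exact ClassicalFieldTheory.alternatingMapLinearEquiv_bijective hmx fun h =>
    hη.ne_zero x (ContinuousAlternatingMap.toAlternatingMap_injective h)

variable [IsManifold 𝓘(ℝ, B) ∞ M]

theorem localFrame_eq_mfderiv_chartAt_symm (b : Module.Basis (Fin m) ℝ B) {x₀ x : M}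
    (hx : x ∈ (chartAt B x₀).source) (i : Fin m) :
    (trivializationAt B (TangentSpace 𝓘(ℝ, B) : M → Type _) x₀).localFrame b i x =
      mfderiv 𝓘(ℝ, B) 𝓘(ℝ, B) (chartAt B x₀).symm (chartAt B x₀ x) (b i) := by
  let T := trivializationAt B (TangentSpace 𝓘(ℝ, B) : M → Type _) x₀
  have hsymm := DFunLike.congr_fun (TangentBundle.symmL_trivializationAt (I := 𝓘(ℝ, B)) hx) (b i)
  rw [ModelWithCorners.range_eq_univ, mfderivWithin_univ] at hsymm
  rw [T.localFrame_apply_of_mem_baseSet b hx]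
  simp only [Bundle.Trivialization.basisAt, Module.Basis.map_apply]
  exact (T.symmL_apply hx (b i)).symm.trans hsymm

theorem IsSmoothForm.contMDiffOn_localFrame
    {η : ∀ x : M, TangentSpace 𝓘(ℝ, B) x [⋀^Fin m]→L[ℝ] ℝ} (hη : IsSmoothForm η)
    (b : Module.Basis (Fin m) ℝ B) (x₀ : M) :
    ContMDiffOn 𝓘(ℝ, B) 𝓘(ℝ, ℝ) ∞
      (fun x => η x fun i =>
        (trivializationAt B (TangentSpace 𝓘(ℝ, B) : M → Type _) x₀).localFrame b i x)
      (chartAt B x₀).source := by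
  have hchart : ContDiffOn ℝ ∞ (fun y => formInChart η x₀ y fun i => b i) (chartAt B x₀).target :=
    (ContinuousAlternatingMap.apply ℝ B ℝ fun i => b i).contDiff.comp_contDiffOn (hη x₀)
  refine (hchart.contMDiffOn.comp (contMDiffOn_chart (I := 𝓘(ℝ, B)))
    fun x hx => (chartAt B x₀).map_source hx).congr fun x hx => ?_
  simp only [localFrame_eq_mfderiv_chartAt_symm b hx]
  let η' : M → B [⋀^Fin m]→L[ℝ] ℝ := η
  have hη' : η' ((chartAt B x₀).symm (chartAt B x₀ x)) = η' x := by
    rw [(chartAt B x₀).left_inv hx]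
  exact (DFunLike.congr_fun hη' _).symm

theorem exists_isSmoothVectorFieldOn_ιMulti_eq_smul {U : Set M} {c : M → ℝ}
    (hc : ContMDiffOn 𝓘(ℝ, B) 𝓘(ℝ, ℝ) ∞ c U) {Y : Fin (m + 1) → ∀ x : M, TangentSpace 𝓘(ℝ, B) x}
    (hY : ∀ i, IsSmoothVectorFieldOn (Y i) U) :
    ∃ Y' : Fin (m + 1) → ∀ x : M, TangentSpace 𝓘(ℝ, B) x, (∀ i, IsSmoothVectorFieldOn (Y' i) U) ∧
      ∀ x, exteriorPower.ιMulti ℝ (m + 1) (fun i => Y' i x) =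
        c x • exteriorPower.ιMulti ℝ (m + 1) fun i => Y i x := by
  refine ⟨Function.update Y 0 fun x => c x • Y 0 x,
    (Function.forall_update_iff Y fun _ Z => IsSmoothVectorFieldOn Z U).2
      ⟨hc.smul_section (hY 0), fun i _ => hY i⟩, fun x => ?_⟩
  have hupdate : (fun i => Function.update Y 0 (fun x => c x • Y 0 x) i x) =
      Function.update (fun i => Y i x) 0 (c x • Y 0 x) :=
    funext fun i => Function.apply_update (fun _ Z => Z x) Y 0 _ i
  rw [hupdate, AlternatingMap.map_update_smul, Function.update_eq_self]

variable [FiniteDimensional ℝ B]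

theorem IsVolumeForm.isLocallyDecomposable_of_apply_eq_one
    {η : ∀ x : M, TangentSpace 𝓘(ℝ, B) x [⋀^Fin (m + 1)]→L[ℝ] ℝ} (hη : IsVolumeForm η)
    (hm : Module.finrank ℝ B = m + 1) {Z : ∀ x : M, ⋀[ℝ]^(m + 1) (TangentSpace 𝓘(ℝ, B) x)}
    (hZ : ∀ x, exteriorPower.alternatingMapLinearEquiv (η x).toAlternatingMap (Z x) = 1) :
    IsLocallyDecomposable Z := fun x₀ => by
  let φ : ∀ x : M, ⋀[ℝ]^(m + 1) (TangentSpace 𝓘(ℝ, B) x) →ₗ[ℝ] ℝ := fun x =>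
    exteriorPower.alternatingMapLinearEquiv (η x).toAlternatingMap
  have hφ : ∀ x, Function.Injective (φ x) := fun x =>
    (hη.alternatingMapLinearEquiv_bijective hm x).injective
  let T := trivializationAt B (TangentSpace 𝓘(ℝ, B) : M → Type _) x₀
  let b := Module.finBasisOfFinrankEq ℝ B hm
  have hφY : ∀ x, φ x (exteriorPower.ιMulti ℝ (m + 1) fun i => T.localFrame b i x) =
      η x fun i => T.localFrame b i x := fun x =>
    exteriorPower.alternatingMapLinearEquiv_apply_ιMulti _ _
  have hηY : ∀ x ∈ T.baseSet, (η x fun i => T.localFrame b i x) ≠ 0 := fun x hx => by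
    rw [← hφY, map_ne_zero_iff _ (hφ x)]
    exact ιMulti_ne_zero_iff.2
      ((T.isLocalFrameOn_localFrame_baseSet 𝓘(ℝ, B) ∞ b).linearIndependent hx)
  obtain ⟨Y', hY', hY'_eq⟩ := exists_isSmoothVectorFieldOn_ιMulti_eq_smul
    ((hη.smooth.contMDiffOn_localFrame b x₀).inv₀ hηY) (T.contMDiffOn_localFrame_baseSet ∞ b)
  refine ⟨T.baseSet, T.open_baseSet, FiberBundle.mem_baseSet_trivializationAt' x₀, Y', hY',
    fun x hx => hφ x ?_⟩
  rw [hY'_eq, map_smul, hφY, hZ]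
  exact (inv_mul_cancel₀ (hηY x hx)).symm

theorem IsVolumeForm.exists_isLocallyDecomposable
    {η : ∀ x : M, TangentSpace 𝓘(ℝ, B) x [⋀^Fin m]→L[ℝ] ℝ} (hη : IsVolumeForm η)
    (hm : Module.finrank ℝ B = m) :
    ∃ Z : ∀ x : M, ⋀[ℝ]^m (TangentSpace 𝓘(ℝ, B) x), (∀ x, Z x ≠ 0) ∧
      IsLocallyDecomposable Z := by
  cases m with
  | zero =>
    exact ⟨fun x => exteriorPower.ιMulti ℝ 0 finZeroElim,
      fun x => ιMulti_ne_zero_iff.2 linearIndependent_empty_type,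
      fun x₀ => ⟨univ, isOpen_univ, trivial, finZeroElim, finZeroElim,
        fun x _ => congrArg _ (Subsingleton.elim _ _)⟩⟩
  | succ m =>
    choose Z hZ using fun x => (hη.alternatingMapLinearEquiv_bijective hm x).surjective 1
    refine ⟨Z, fun x h0 => one_ne_zero (α := ℝ) ?_, hη.isLocallyDecomposable_of_apply_eq_one hm hZ⟩
    exact (hZ x).symm.trans ((congrArg _ h0).trans (map_zero _))

theorem IsVolumeForm.multivectorClass_nonempty {V N : Type*} [NormedAddCommGroup V]
    [NormedSpace ℝ V] [TopologicalSpace N] [ChartedSpace V N] [IsManifold 𝓘(ℝ, V) ∞ N]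
    {η : ∀ x : M, TangentSpace 𝓘(ℝ, B) x [⋀^Fin m]→L[ℝ] ℝ} (hη : IsVolumeForm η)
    (hm : Module.finrank ℝ B = m) {D : TangentDistribution V N m} {q : N → M}
    (hD : D.IsTransverse (B := B) q) (hq : ContMDiff 𝓘(ℝ, V) 𝓘(ℝ, B) ∞ q) :
    D.multivectorClass.Nonempty := by
  obtain ⟨Z, hZ0, hZ⟩ := hη.exists_isLocallyDecomposable hm
  obtain ⟨X, hX, -⟩ := hD.exists_mem_multivectorClass_map_eq hq hm (fun y => hZ0 (q y))
    (IsLocallyDecomposableAlong.comp (q := id) hZ hq)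
  exact ⟨X, hX⟩

end VolumeForm

section JetBundle

variable {B EE F : Type*}
  [NormedAddCommGroup B] [NormedSpace ℝ B] [CompleteSpace B]
  [NormedAddCommGroup EE] [NormedSpace ℝ EE]
  [NormedAddCommGroup F] [NormedSpace ℝ F]
  {M E S : Type*}
  [TopologicalSpace M] [ChartedSpace B M] [IsManifold 𝓘(ℝ, B) ∞ M]
  [TopologicalSpace E] [ChartedSpace EE E]
  [TopologicalSpace S] [ChartedSpace F S] [IsManifold 𝓘(ℝ, F) ∞ S]
  {p : SmoothFiberBundle B EE F M E S}

theorem Jet.contMDiff_pt :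
    ContMDiff 𝓘(ℝ, (B × F) × (B →L[ℝ] F)) 𝓘(ℝ, EE) ∞ (Jet.pt : Jet p → E) := by
  intro j
  let c := (AdaptedChart.exists_mem p j.pt).choose
  let e := chartAt ((B × F) × (B →L[ℝ] F)) j
  have hpt_mem : ∀ j' ∈ e.source, j'.pt ∈ c.tot.source := fun _ hj' => hj'
  have htot_pt : ContMDiffOn 𝓘(ℝ, (B × F) × (B →L[ℝ] F)) 𝓘(ℝ, B × F) ∞
      (fun j' => c.tot j'.pt) e.source :=
    contDiff_fst.contMDiff.comp_contMDiffOn contMDiffOn_chart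
  have hpt : ContMDiffOn 𝓘(ℝ, (B × F) × (B →L[ℝ] F)) 𝓘(ℝ, EE) ∞ (Jet.pt : Jet p → E) e.source :=
    (c.contMDiffOn_tot_symm.comp htot_pt fun j' hj' => c.tot.map_source (hpt_mem j' hj')).congr
      fun j' hj' => (c.tot.left_inv (hpt_mem j' hj')).symm
  exact hpt.contMDiffAt (e.open_source.mem_nhds (mem_chart_source _ j))

end JetBundle

end ClassicalFieldTheory

theorem mainTheorem6_general {V N V' N' B M : Type*}
    [NormedAddCommGroup V] [NormedSpace ℝ V] [TopologicalSpace N] [ChartedSpace V N]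
    [IsManifold 𝓘(ℝ, V) ∞ N]
    [NormedAddCommGroup V'] [NormedSpace ℝ V'] [TopologicalSpace N'] [ChartedSpace V' N']
    [IsManifold 𝓘(ℝ, V') ∞ N']
    [NormedAddCommGroup B] [NormedSpace ℝ B] [FiniteDimensional ℝ B]
    [TopologicalSpace M] [ChartedSpace B M] [IsManifold 𝓘(ℝ, B) ∞ M]
    {k : ℕ} (hk : Module.finrank ℝ B = k) {q : N → M} {r : N' → N} {Ψ : N → N'}
    (hq : ContMDiff 𝓘(ℝ, V) 𝓘(ℝ, B) ∞ q) (hr : ContMDiff 𝓘(ℝ, V') 𝓘(ℝ, V) ∞ r)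
    (hΨ : ContMDiff 𝓘(ℝ, V) 𝓘(ℝ, V') ∞ Ψ) (hrΨ : r ∘ Ψ = id)
    {D : TangentDistribution V N k} {D' : TangentDistribution V' N' k}
    (hDint : D.IsIntegrable) (hD : D.IsTransverse (B := B) q)
    (hD' : D'.IsTransverse (B := B) (q ∘ r)) (hne : D'.multivectorClass.Nonempty) :
    (∀ (U : Set M) (γ : M → N), IsLocalSection (B := B) (V := V) q U γ →
      D.IsIntegralSectionOn (B := B) U γ → D'.IsIntegralSectionOn (B := B) U (Ψ ∘ γ)) ↔
      TangentDistribution.IsRelated Ψ D D' := by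
  rw [hDint.forall_isIntegralSectionOn_comp_iff hq hD hk hΨ]
  exact ⟨TangentDistribution.isRelated_of_map_space_eq hD hD' hq hr hΨ hrΨ hk,
    fun h => h.map_space_eq hne⟩

theorem mainTheorem6 {m n : ℕ} {M E S : Type*}
    [TopologicalSpace M] [ChartedSpace (EuclideanSpace ℝ (Fin m)) M]
    [IsManifold 𝓘(ℝ, EuclideanSpace ℝ (Fin m)) ∞ M] [T2Space M] [SecondCountableTopology M]
    [TopologicalSpace E] [ChartedSpace (EuclideanSpace ℝ (Fin (m + n))) E]
    [IsManifold 𝓘(ℝ, EuclideanSpace ℝ (Fin (m + n))) ∞ E] [T2Space E] [SecondCountableTopology E]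
    [TopologicalSpace S] [ChartedSpace (EuclideanSpace ℝ (Fin n)) S]
    [IsManifold 𝓘(ℝ, EuclideanSpace ℝ (Fin n)) ∞ S]
    (p : SmoothFiberBundle (EuclideanSpace ℝ (Fin m)) (EuclideanSpace ℝ (Fin (m + n)))
      (EuclideanSpace ℝ (Fin n)) M E S)
    (η : ∀ x : M, TangentSpace 𝓘(ℝ, EuclideanSpace ℝ (Fin m)) x [⋀^Fin m]→L[ℝ] ℝ)
    (hη : IsVolumeForm η)
    (L : Jet p → ℝ)
    (hL : ContMDiff 𝓘(ℝ, (EuclideanSpace ℝ (Fin m) × EuclideanSpace ℝ (Fin n)) ×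
      (EuclideanSpace ℝ (Fin m) →L[ℝ] EuclideanSpace ℝ (Fin n))) 𝓘(ℝ, ℝ) ∞ L)
    (hreg : IsRegularLagrangian L)
    (DL : TangentDistribution ((EuclideanSpace ℝ (Fin m) × EuclideanSpace ℝ (Fin n)) ×
      (EuclideanSpace ℝ (Fin m) →L[ℝ] EuclideanSpace ℝ (Fin n))) (Jet p) m)
    (hDL : IsLagrangianDistribution η L DL)
    (Ψ : JetField p)
    (D : TangentDistribution (EuclideanSpace ℝ (Fin (m + n))) E m)
    (hDint : D.IsIntegrable)
    (hDtr : D.IsTransverse (B := EuclideanSpace ℝ (Fin m)) p.proj) :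
    SatisfiesHJCondition Ψ D DL ↔ TangentDistribution.IsRelated Ψ.toFun D DL := by
  have hq : ContMDiff _ _ ∞ p.proj := p.contMDiff_proj
  exact mainTheorem6_general finrank_euclideanSpace_fin hq Jet.contMDiff_pt Ψ.contMDiff
    (funext Ψ.pt_toFun) hDint hDtr hDL.transverse
    (hη.multivectorClass_nonempty finrank_euclideanSpace_fin hDL.transverse
      (hq.comp Jet.contMDiff_pt))
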